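/- Let $q\equiv 3 \pmod 4$ be a prime power and let $n\ge 1$ be an odd integer with $\gcd(q,4n)=1$. Let $Q_n=\langle a,b \mid a^{2n}=1,\ b^2=a^n,\ b^{-1}ab=a^{-1}\rangle$ be the generalised quaternion group of order $4n$. A $Q_n$-code over $\mathbb F_q$ is a left ideal $I$ of $\mathbb F_q[Q_n]$. Put $(x|y)=\sum_{h\in Q_n}x_hy_h$ and $I^{\perp_E}=\{y\in\mathbb F_q[Q_n] : (x|y)=0 \text{ for all } x\in I\}$; the code $I$ is called euclidean self-orthogonal if $I\subseteq I^{\perp_E}$. For $f\in\mathbb F_q[x]$ with $f(0)\ne 0$ let $f^*(x)=f(0)^{-1}x^{\deg f}f(x^{-1})$. Factorise into monic irreducible polynomials over $\mathbb F_q$ $$x^n-1=f_1\cdots f_r\,f_{r+1}f_{r+1}^*\cdots f_{r+s}f_{r+s}^*,\qquad x^n+1=g_1\cdots g_t\,g_{t+1}g_{t+1}^*\cdots g_{t+k}g_{t+k}^*,$$ where $f_1=x-1$, $g_1=x+1$, $f_i=f_i^*$ for $i\le r$, $f_i\ne f_i^*$ for $i>r$, $g_j=g_j^*$ for $j\le t$,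 $g_j\neq g_j^*$ for $j>t$. In an extension field of $\mathbb F_q$ choose a root $\alpha_i$ of each $f_i$, a root $\beta_j$ of each $g_j$ and a square root $\sqrt{-1}$ of $-1$; for $2\le j\le t$ with $4\nmid\deg g_j$ choose $u_j,v_j\in\mathbb F_q(\beta_j+\beta_j^{-1})$ with $u_j^2+v_j^2=-1$. Let $$A_1=\mathbb F_q\oplus\mathbb F_q,\quad A_i=M_2(\mathbb F_q(\alpha_i+\alpha_i^{-1}))\ (2\le i\le r),\quad A_i=M_2(\mathbb F_q(\alpha_i))\ (r<i\le r+s),$$ $$B_1=\mathbb F_q(\sqrt{-1}),\quad B_j=M_2(\mathbb F_q(\beta_j+\beta_j^{-1}))\ (2\le j\le t),\quad B_j=M_2(\mathbb F_q(\beta_j))\ (t<j\le t+k).$$ Then there is an isomorphism of $\mathbb F_q$-algebras $\psi=\bigoplus_i\rho_i\oplus\bigoplus_j\eta_j:\mathbb F_q[Q_n]\to\bigoplus_{i=1}^{r+s}A_i\oplus\bigoplus_{j=1}^{t+k}B_j$ with the following values on the generators. * $\rho_1(a)=(1,1)$, $\rho_1(b)=(1,-1)$; $\ \eta_1(a)=-1$,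 $\eta_1(b)=\sqrt{-1}$. * For $2\le i\le r$: $\rho_i(a)=Z^{-1}\left[\begin{smallmatrix}\alpha_i&0\\0&\alpha_i^{-1}\end{smallmatrix}\right]Z$, $\rho_i(b)=Z^{-1}\left[\begin{smallmatrix}0&1\\1&0\end{smallmatrix}\right]Z$, where $Z=\left[\begin{smallmatrix}1&-\alpha_i\\1&-\alpha_i^{-1}\end{smallmatrix}\right]$. * For $r<i\le r+s$: $\rho_i(a)=\left[\begin{smallmatrix}\alpha_i&0\\0&\alpha_i^{-1}\end{smallmatrix}\right]$, $\rho_i(b)=\left[\begin{smallmatrix}0&1\\1&0\end{smallmatrix}\right]$. * For $2\le j\le t$: $\eta_j(a)=\tau_j\left(\left[\begin{smallmatrix}\beta_j&0\\0&\beta_j^{-1}\end{smallmatrix}\right]\right)$, $\eta_j(b)=\tau_j\left(\left[\begin{smallmatrix}0&\sqrt{-1}\\\sqrt{-1}&0\end{smallmatrix}\right]\right)$. If $4\mid\deg g_j$, then $\tau_j(X)=Z^{-1}XZ$ with $Z=\left[\begin{smallmatrix}\sqrt{-1}&-\beta_j\\\sqrt{-1}&-\beta_j^{-1}\end{smallmatrix}\right]$.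 If $4\nmid\deg g_j$, then, with $u=u_j$, $v=v_j$ and $x_1,\dots,x_4\in\mathbb F_q(\beta_j+\beta_j^{-1})$, $$\tau_j:\begin{bmatrix}x_1+x_2\sqrt{-1}&x_3+x_4\sqrt{-1}\\-(x_3-x_4\sqrt{-1})&x_1-x_2\sqrt{-1}\end{bmatrix}\mapsto\begin{bmatrix}x_1+x_2u-x_4v&x_3+x_2v+x_4u\\-x_3+x_2v+x_4u&x_1-x_2u+x_4v\end{bmatrix}.$$ * For $t<j\le t+k$: $\eta_j(a)=\left[\begin{smallmatrix}\beta_j&0\\0&\beta_j^{-1}\end{smallmatrix}\right]$, $\eta_j(b)=\left[\begin{smallmatrix}0&-1\\1&0\end{smallmatrix}\right]$. Every left ideal $I$ of $\mathbb F_q[Q_n]$ satisfies $\psi(I)=\bigoplus_{i}\langle M_i\rangle_{A_i}\oplus\bigoplus_{j}\langle N_j\rangle_{B_j}$ (left ideals generated by $M_i$, $N_j$) for unique $M_i\in A_i$, $N_j\in B_j$ in row reduced echelon form (for the entries in $\mathbb F_q$, $\mathbb F_q$ and $\mathbb F_q(\sqrt{-1})$ of $M_1$ and $N_1$ this means being $0$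 or $1$), and $I$ is euclidean self-orthogonal if and only if 1. $\langle M_1\rangle_{A_1}=0\oplus 0$; 2. $\langle M_i\rangle_{A_i}=0$ for $2\le i\le r$; 3. $M_i\in\left\{\left[\begin{smallmatrix}0&0\\0&0\end{smallmatrix}\right],\left[\begin{smallmatrix}0&1\\0&0\end{smallmatrix}\right],\left[\begin{smallmatrix}1&0\\0&0\end{smallmatrix}\right]\right\}$ for $r+1\le i\le r+s$; 4. $\langle N_j\rangle_{B_j}$ is strictly contained in $B_j$ for $1\le j\le t+k$. In particular, there are exactly $$3^{s}\prod_{j=2}^{t}\left(q^{\deg(g_j)/2}+2\right)\prod_{j=t+1}^{t+k}\left(q^{\deg(g_j)}+2\right)$$ euclidean self-orthogonal $Q_n$-codes over $\mathbb F_q$. -/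

import Mathlib

open Polynomial
open scoped IntermediateField

namespace QuatCode

/-! ### Group codes and the euclidean dual -/

section Codes

variable {F G : Type*} [Field F] [Group G] [Fintype G]

/-- The euclidean inner product `(a|b) = ∑ g, a_g b_g` on the group algebra `F[G]`. -/
def euclideanInner (a b : MonoidAlgebra F G) : F := ∑ g : G, a.coeff g * b.coeff g

/-- The euclidean dual `{b | (a|b) = 0 for all a ∈ I}` of a left ideal `I` of `F[G]`.
In Mathlib `Ideal R` is the type of left ideals of a noncommutative ring `R`. -/
def euclideanDual (I : Ideal (MonoidAlgebra F G)) : Set (MonoidAlgebra F G) :=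
  {b | ∀ a ∈ I, euclideanInner a b = 0}

/-- A (left) `G`-code is a left ideal of `F[G]`; it is euclidean self-orthogonal if it is
contained in its euclidean dual. -/
def IsSelfOrthogonal (I : Ideal (MonoidAlgebra F G)) : Prop :=
  (I : Set (MonoidAlgebra F G)) ⊆ euclideanDual I

end Codes

/-! ### Reciprocal polynomials and the factorisations of `x ^ n - 1` and `x ^ n + 1` -/

section Factorisation

variable {F : Type*} [Field F]

/-- The (monic) reciprocal polynomial `g*(x) = g(0)⁻¹ x ^ deg g g(x⁻¹)`. -/
noncomputable def recip (g : F[X]) : F[X] := C (g.coeff 0)⁻¹ * g.reverse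

/-- `P = f₁ ⋯ f_r · (f_{r+1} f_{r+1}*) ⋯ (f_{r+s} f_{r+s}*)` is the factorisation of `P` into monic
irreducible polynomials, with `f₁ = l`, the factors `f₁, …, f_r` being the self-reciprocal ones.
Only the values `f i` with `1 ≤ i ≤ r + s` are relevant. -/
structure IsReciprocalFactorisation (P l : F[X]) (r s : ℕ) (f : ℕ → F[X]) : Prop where
  one_le : 1 ≤ r
  first : f 1 = l
  monic : ∀ i ∈ Finset.Icc 1 (r + s), (f i).Monic
  irreducible : ∀ i ∈ Finset.Icc 1 (r + s), Irreducible (f i)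
  selfReciprocal : ∀ i ∈ Finset.Icc 1 r, recip (f i) = f i
  not_selfReciprocal : ∀ i ∈ Finset.Icc (r + 1) (r + s), recip (f i) ≠ f i
  prod_eq : P = (∏ i ∈ Finset.Icc 1 r, f i) *
    ∏ i ∈ Finset.Icc (r + 1) (r + s), f i * recip (f i)

end Factorisation

/-! ### The algebra `⨁ A_i ⊕ ⨁ B_j` -/

section Algebras

/-- `2 × 2` matrices. -/
abbrev M2 (R : Type*) := Matrix (Fin 2) (Fin 2) R

variable (F : Type*) {K : Type*} [Field F] [Field K] [Algebra F K]

/-- The sum of the `A_i`, `1 ≤ i ≤ r + s`: `F ⊕ F` for `i = 1`, then `M₂(F(α_i + α_i⁻¹))` for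
`2 ≤ i ≤ r`, then `M₂(F(α_i))` for `r + 1 ≤ i ≤ r + s`. -/
abbrev AlgA (r s : ℕ) (α : ℕ → K) : Type _ :=
  (F × F) × ((i : Finset.Icc 2 r) → M2 F⟮α i + (α i)⁻¹⟯) ×
    ((i : Finset.Icc (r + 1) (r + s)) → M2 F⟮α i⟯)

/-- The sum of the `B_j`, `1 ≤ j ≤ t + k`: `F(√-1)` for `j = 1`, then `M₂(F(β_j + β_j⁻¹))` for
`2 ≤ j ≤ t`, then `M₂(F(β_j))` for `t + 1 ≤ j ≤ t + k`. Here `ι = √-1`. -/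
abbrev AlgB (t k : ℕ) (β : ℕ → K) (ι : K) : Type _ :=
  F⟮ι⟯ × ((j : Finset.Icc 2 t) → M2 F⟮β j + (β j)⁻¹⟯) ×
    ((j : Finset.Icc (t + 1) (t + k)) → M2 F⟮β j⟯)

end Algebras

/-! ### The images of the generators of `Q_n` -/

section Generators

variable {K : Type*} [Field K]

/-- `σ(X) = Z⁻¹ X Z` for `Z = [1, -α; 1, -α⁻¹]`. -/
noncomputable def sigmaMap (α : K) (X : M2 K) : M2 K :=
  (!![1, -α; 1, -α⁻¹] : M2 K)⁻¹ * X * !![1, -α; 1, -α⁻¹]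

/-- `γ(X) = Z⁻¹ X Z` for `Z = [√-1, -β; √-1, -β⁻¹]`, where `ι = √-1`. -/
noncomputable def gammaMap (ι β : K) (X : M2 K) : M2 K :=
  (!![ι, -β; ι, -β⁻¹] : M2 K)⁻¹ * X * !![ι, -β; ι, -β⁻¹]

/-- The map `θ` sending `[x₁ + x₂√-1, x₃ + x₄√-1; -(x₃ - x₄√-1), x₁ - x₂√-1]` to
`[x₁ + x₂u - x₄v, x₃ + x₂v + x₄u; -x₃ + x₂v + x₄u, x₁ - x₂u + x₄v]`, where `ι = √-1`: the
coordinates `x₁, x₂, x₃, x₄` are recovered from the entries of the matrix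
(see `thetaMap_apply`). -/
noncomputable def thetaMap (ι u v : K) (X : M2 K) : M2 K :=
  let x₁ := (X 0 0 + X 1 1) / 2
  let x₂ := (X 0 0 - X 1 1) / (2 * ι)
  let x₃ := (X 0 1 - X 1 0) / 2
  let x₄ := (X 0 1 + X 1 0) / (2 * ι)
  !![x₁ + x₂ * u - x₄ * v, x₃ + x₂ * v + x₄ * u;
    -x₃ + x₂ * v + x₄ * u, x₁ - x₂ * u + x₄ * v]

theorem thetaMap_apply (h2 : (2 : K) ≠ 0) {ι : K} (hι : ι ^ 2 = -1) (u v x₁ x₂ x₃ x₄ : K) :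
    thetaMap ι u v !![x₁ + x₂ * ι, x₃ + x₄ * ι; -(x₃ - x₄ * ι), x₁ - x₂ * ι] =
      !![x₁ + x₂ * u - x₄ * v, x₃ + x₂ * v + x₄ * u;
        -x₃ + x₂ * v + x₄ * u, x₁ - x₂ * u + x₄ * v] := by
  have hι0 : ι ≠ 0 := by
    rintro rfl
    norm_num at hι
  ext i j
  fin_cases i <;> fin_cases j <;> simp [thetaMap] <;> field_simp <;> ring

end Generators

section Iso

variable {F K : Type*} [Field F] [Field K] [Algebra F K]

/-- The entries of a matrix over an intermediate field, viewed in the big field. -/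
def toK {L : IntermediateField F K} (X : M2 L) : M2 K := X.map (fun x => (x : K))

/-- `y ∈ ⨁ A_i` is the tuple of the images `ρ_i(a)`. -/
structure IsRhoA (r s : ℕ) (α : ℕ → K) (y : AlgA F r s α) : Prop where
  one : y.1 = (1, 1)
  self : ∀ i : Finset.Icc 2 r, toK (y.2.1 i) = sigmaMap (α i) !![α i, 0; 0, (α i)⁻¹]
  pair : ∀ i : Finset.Icc (r + 1) (r + s), toK (y.2.2 i) = !![α i, 0; 0, (α i)⁻¹]

/-- `y ∈ ⨁ A_i` is the tuple of the images `ρ_i(b)`. -/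
structure IsRhoB (r s : ℕ) (α : ℕ → K) (y : AlgA F r s α) : Prop where
  one : y.1 = (1, -1)
  self : ∀ i : Finset.Icc 2 r, toK (y.2.1 i) = sigmaMap (α i) !![0, 1; 1, 0]
  pair : ∀ i : Finset.Icc (r + 1) (r + s), toK (y.2.2 i) = !![0, 1; 1, 0]

/-- `z ∈ ⨁ B_j` is the tuple of the images `η_j(a)`. -/
structure IsEtaA (t k : ℕ) (g : ℕ → F[X]) (β : ℕ → K) (ι : K) (u v : ℕ → K)
    (z : AlgB F t k β ι) : Prop where
  one : z.1 = -1
  self_four : ∀ j : Finset.Icc 2 t, 4 ∣ (g j).natDegree →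
    toK (z.2.1 j) = gammaMap ι (β j) !![β j, 0; 0, (β j)⁻¹]
  self_two : ∀ j : Finset.Icc 2 t, ¬ 4 ∣ (g j).natDegree →
    toK (z.2.1 j) = thetaMap ι (u j) (v j) !![β j, 0; 0, (β j)⁻¹]
  pair : ∀ j : Finset.Icc (t + 1) (t + k), toK (z.2.2 j) = !![β j, 0; 0, (β j)⁻¹]

/-- `z ∈ ⨁ B_j` is the tuple of the images `η_j(b)`. -/
structure IsEtaB (t k : ℕ) (g : ℕ → F[X]) (β : ℕ → K) (ι : K) (u v : ℕ → K)
    (z : AlgB F t k β ι) : Prop where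
  one : (z.1 : K) = ι
  self_four : ∀ j : Finset.Icc 2 t, 4 ∣ (g j).natDegree →
    toK (z.2.1 j) = gammaMap ι (β j) !![0, ι; ι, 0]
  self_two : ∀ j : Finset.Icc 2 t, ¬ 4 ∣ (g j).natDegree →
    toK (z.2.1 j) = thetaMap ι (u j) (v j) !![0, ι; ι, 0]
  pair : ∀ j : Finset.Icc (t + 1) (t + k), toK (z.2.2 j) = !![0, -1; 1, 0]

/-- `ψ = ⨁ ρ_i ⊕ ⨁ η_j`: the isomorphism of `F`-algebras on `F[Q_n]` determined by the prescribed
images of the generators `a` (`QuaternionGroup.a 1`) and `b` (`QuaternionGroup.xa 0`) of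
`Q_n = ⟨a, b | a ^ (2n) = 1, b ^ 2 = a ^ n, b⁻¹ a b = a⁻¹⟩`. -/
structure IsPsi (n r s t k : ℕ) (g : ℕ → F[X]) (α β : ℕ → K) (ι : K) (u v : ℕ → K)
    (ψ : MonoidAlgebra F (QuaternionGroup n) ≃ₐ[F] AlgA F r s α × AlgB F t k β ι) : Prop where
  rho_a : IsRhoA r s α (ψ (MonoidAlgebra.of F _ (QuaternionGroup.a 1))).1
  rho_b : IsRhoB r s α (ψ (MonoidAlgebra.of F _ (QuaternionGroup.xa 0))).1
  eta_a : IsEtaA t k g β ι u v (ψ (MonoidAlgebra.of F _ (QuaternionGroup.a 1))).2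
  eta_b : IsEtaB t k g β ι u v (ψ (MonoidAlgebra.of F _ (QuaternionGroup.xa 0))).2

/-! ### Left ideals of `⨁ A_i ⊕ ⨁ B_j` and their generators -/

/-- A `2 × 2` matrix over a field in row reduced echelon form. -/
def IsRREF {L : Type*} [Field L] (M : M2 L) : Prop :=
  M = !![0, 0; 0, 0] ∨ M = !![0, 1; 0, 0] ∨ (∃ c : L, M = !![1, c; 0, 0]) ∨ M = !![1, 0; 0, 1]

/-- Every component of `(M, N) ∈ ⨁ A_i ⊕ ⨁ B_j` is in row reduced echelon form; for the components
`F`, `F` and `F(√-1)` (`1 × 1` matrices) this means that the entry is `0` or `1`. -/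
structure AllRREF {r s t k : ℕ} {α β : ℕ → K} {ι : K}
    (M : AlgA F r s α) (N : AlgB F t k β ι) : Prop where
  A_one : (M.1.1 = 0 ∨ M.1.1 = 1) ∧ (M.1.2 = 0 ∨ M.1.2 = 1)
  A_self : ∀ i, IsRREF (M.2.1 i)
  A_pair : ∀ i, IsRREF (M.2.2 i)
  B_one : N.1 = 0 ∨ N.1 = 1
  B_self : ∀ j, IsRREF (N.2.1 j)
  B_pair : ∀ j, IsRREF (N.2.2 j)

/-- The set `⨁ ⟨M_i⟩ ⊕ ⨁ ⟨N_j⟩`, where `⟨M⟩ = Ideal.span {M}` is the left ideal generated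
by `M` in its component. -/
def sumSpan {r s t k : ℕ} {α β : ℕ → K} {ι : K}
    (M : AlgA F r s α) (N : AlgB F t k β ι) : Set (AlgA F r s α × AlgB F t k β ι) :=
  {x | x.1.1 ∈ Ideal.span {M.1} ∧
    (∀ i, x.1.2.1 i ∈ Ideal.span {M.2.1 i}) ∧
    (∀ i, x.1.2.2 i ∈ Ideal.span {M.2.2 i}) ∧
    x.2.1 ∈ Ideal.span {N.1} ∧
    (∀ j, x.2.2.1 j ∈ Ideal.span {N.2.1 j}) ∧
    (∀ j, x.2.2.2 j ∈ Ideal.span {N.2.2 j})}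

/-- The componentwise conditions on `(M, N)`. -/
structure SelfOrthogonalConditions {r s t k : ℕ} {α β : ℕ → K} {ι : K}
    (M : AlgA F r s α) (N : AlgB F t k β ι) : Prop where
  A_one : Ideal.span {M.1} = ⊥
  A_self : ∀ i, Ideal.span {M.2.1 i} = ⊥
  A_pair : ∀ i, M.2.2 i = !![0, 0; 0, 0] ∨ M.2.2 i = !![0, 1; 0, 0] ∨ M.2.2 i = !![1, 0; 0, 0]
  B_one : Ideal.span {N.1} < ⊤
  B_self : ∀ j, Ideal.span {N.2.1 j} < ⊤
  B_pair : ∀ j, Ideal.span {N.2.2 j} < ⊤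

end Iso

end QuatCode

open QuatCode

/-! Every left ideal in question is principal, I = ⟨m⟩. Let `conj` be the anti-automorphism
inverting group elements. The coefficient of x · conj y at h is (x | hy) (`coeff_mul_conj`), so I is
self-orthogonal iff m · conj m = 0 (`isSelfOrthogonal_span_iff`), an equation that can be tested in
each component of ψ.

On a matrix component φ the group preserves a nondegenerate bilinear form with Gram matrix S, whence
φ(m · conj m) = 0 iff M S Mᵀ = 0 for M = φ(m) (`map_mul_conj_mul_form`). Three kinds of form occur.
For self-reciprocal f_i, i ≥ 2, it is twice the norm form of F(α) over F(α + α⁻¹), which is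
anisotropic and forces M = 0. For a reciprocal pair in X^n - 1 it is a hyperbolic plane, whose
isotropic lines are the two axes. For the factors of X^n + 1 it is alternating, M S Mᵀ = det M · S,
so only invertible M are excluded. On a field component `conj` becomes the q-th power map (for
F(√-1) because q ≡ 3 mod 4), so m · conj m maps to φ(m)^(q+1) and φ(m) = 0.

To construct ψ, the prescribed matrices are conjugate over K to a diagonal and an antidiagonal
matrix, which satisfy the relations of Q_n. That they have entries in L = F(β + β⁻¹) is a Frobenius
argument: if 4 divides deg g_j then √-1 ∈ L, otherwise (β - β⁻¹)/√-1 ∈ L. If P(a) + bQ(a) dies in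
all components, then X^(2n) - 1 divides P and Q (`AreComponents.dvd_of_eq_zero`), so ψ is injective;
both sides have dimension 4n.

The number of codes is then the number of admissible reduced generators; there are |L| + 2 singular
reduced matrices over L (`card_isRREF_lt_top`). -/

namespace QuatCode

/-! ### Normal forms of generators of left ideals -/

section NormalGenerators

/-- Every left ideal of `R` is generated by exactly one element satisfying `P`. -/
def HasNormalGenerators (R : Type*) [Ring R] (P : R → Prop) : Prop :=
  ∀ I : Ideal R, ∃! m : R, P m ∧ I = Ideal.span {m}

theorem mem_span_singleton_prod {R S : Type*} [Ring R] [Ring S] (x m : R × S) :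
    x ∈ Ideal.span {m} ↔ x.1 ∈ Ideal.span {m.1} ∧ x.2 ∈ Ideal.span {m.2} := by
  simp only [Ideal.mem_span_singleton']
  constructor
  · rintro ⟨a, rfl⟩
    exact ⟨⟨a.1, rfl⟩, ⟨a.2, rfl⟩⟩
  · rintro ⟨⟨a, ha⟩, ⟨b, hb⟩⟩
    exact ⟨(a, b), Prod.ext ha hb⟩

theorem mem_span_singleton_pi {ι : Type*} {R : ι → Type*} [∀ i, Ring (R i)] (x m : ∀ i, R i) :
    x ∈ Ideal.span {m} ↔ ∀ i, x i ∈ Ideal.span {m i} := by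
  simp only [Ideal.mem_span_singleton']
  constructor
  · rintro ⟨a, rfl⟩ i
    exact ⟨a i, rfl⟩
  · intro h
    choose a ha using h
    exact ⟨a, funext ha⟩

theorem span_singleton_prod {R S : Type*} [Ring R] [Ring S] (m : R × S) :
    Ideal.span {m} = Ideal.prod (Ideal.span {m.1}) (Ideal.span {m.2}) := by
  ext x
  rw [mem_span_singleton_prod, Ideal.mem_prod]

theorem HasNormalGenerators.prod {R S : Type*} [Ring R] [Ring S] {P : R → Prop} {Q : S → Prop}
    (hP : HasNormalGenerators R P) (hQ : HasNormalGenerators S Q) :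
    HasNormalGenerators (R × S) (fun x => P x.1 ∧ Q x.2) := by
  intro I
  obtain ⟨I₁, I₂, rfl⟩ : ∃ I₁ I₂, I = Ideal.prod I₁ I₂ := ⟨_, _, I.ideal_prod_eq⟩
  obtain ⟨m₁, ⟨hm₁, rfl⟩, u₁⟩ := hP I₁
  obtain ⟨m₂, ⟨hm₂, rfl⟩, u₂⟩ := hQ I₂
  refine ⟨(m₁, m₂), ⟨⟨hm₁, hm₂⟩, (span_singleton_prod (m₁, m₂)).symm⟩, ?_⟩
  rintro ⟨x₁, x₂⟩ ⟨⟨hx₁, hx₂⟩, hx⟩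
  rw [span_singleton_prod, Ideal.prod_inj] at hx
  exact Prod.ext (u₁ _ ⟨hx₁, hx.1⟩) (u₂ _ ⟨hx₂, hx.2⟩)

theorem HasNormalGenerators.pi {ι : Type*} [Fintype ι] {R : ι → Type*}
    [∀ i, Ring (R i)] {P : ∀ i, R i → Prop} (hP : ∀ i, HasNormalGenerators (R i) (P i)) :
    HasNormalGenerators (∀ i, R i) (fun x => ∀ i, P i (x i)) := by
  classical
  intro I
  -- The idempotent `Pi.single i 1` shows that the projection of `I` to a factor is already
  -- contained in `I`.
  have key : ∀ i, ∀ x, x ∈ I.map (Pi.evalRingHom R i) ↔ Pi.single i x ∈ I := by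
    intro i x
    constructor
    · intro hx
      rw [Ideal.mem_map_iff_of_surjective _ (Function.surjective_eval i)] at hx
      obtain ⟨y, hy, rfl⟩ := hx
      have := I.mul_mem_left (Pi.single i 1) hy
      convert this using 1
      ext j
      obtain rfl | h := eq_or_ne j i
      · simp
      · simp [h]
    · intro hx
      simpa using Ideal.mem_map_of_mem (Pi.evalRingHom R i) hx
  have hI : ∀ x, x ∈ I ↔ ∀ i, x i ∈ I.map (Pi.evalRingHom R i) := by
    intro x
    constructor
    · intro hx i
      exact Ideal.mem_map_of_mem (Pi.evalRingHom R i) hx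
    · intro hx
      rw [← Finset.univ_sum_single x]
      exact I.sum_mem fun i _ => (key i _).1 (hx i)
  choose m hm u using fun i => hP i (I.map (Pi.evalRingHom R i))
  refine ⟨m, ⟨fun i => (hm i).1, ?_⟩, ?_⟩
  · ext x
    rw [hI, mem_span_singleton_pi]
    exact forall_congr' fun i => by rw [(hm i).2]
  · rintro y ⟨hy, rfl⟩
    refine funext fun i => u i _ ⟨hy i, ?_⟩
    ext x
    rw [key, mem_span_singleton_pi]
    constructor
    · intro h
      simpa using h i
    · intro h j
      obtain rfl | hj := eq_or_ne j i
      · simpa using h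
      · simp [hj]

theorem hasNormalGenerators_field (L : Type*) [Field L] :
    HasNormalGenerators L (fun x => x = 0 ∨ x = 1) := by
  intro I
  obtain rfl | rfl := I.eq_bot_or_top
  · refine ⟨0, ⟨Or.inl rfl, by simp⟩, ?_⟩
    rintro y ⟨-, hy⟩
    exact Ideal.span_singleton_eq_bot.1 hy.symm
  · refine ⟨1, ⟨Or.inr rfl, by simp⟩, ?_⟩
    rintro y ⟨rfl | rfl, hy⟩
    · simp at hy
    · rfl

end NormalGenerators

/-! ### Left ideals of 2 × 2 matrices over a field, and isotropic row spaces. -/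

section MatrixIdeals

theorem transpose_of_fin_two {R : Type*} (a b c d : R) :
    (!![a, b; c, d] : M2 R).transpose = !![a, c; b, d] := by
  ext i j
  fin_cases i <;> fin_cases j <;> rfl

variable {L : Type*} [Field L]

theorem mem_span_one_row (c : L) (X : M2 L) :
    X ∈ Ideal.span {(!![1, c; 0, 0] : M2 L)} ↔ X 0 1 = X 0 0 * c ∧ X 1 1 = X 1 0 * c := by
  rw [Ideal.mem_span_singleton']
  constructor
  · rintro ⟨a, rfl⟩
    simp [Matrix.mul_apply, Fin.sum_univ_two]
  · rintro ⟨h0, h1⟩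
    refine ⟨X, ?_⟩
    ext i j
    fin_cases i <;> fin_cases j <;> simp [Matrix.mul_apply, Fin.sum_univ_two, h0, h1]

theorem mem_span_zero_one_row (X : M2 L) :
    X ∈ Ideal.span {(!![0, 1; 0, 0] : M2 L)} ↔ X 0 0 = 0 ∧ X 1 0 = 0 := by
  rw [Ideal.mem_span_singleton']
  constructor
  · rintro ⟨a, rfl⟩
    simp [Matrix.mul_apply, Fin.sum_univ_two]
  · rintro ⟨h0, h1⟩
    refine ⟨!![X 0 1, 0; X 1 1, 0], ?_⟩
    ext i j
    fin_cases i <;> fin_cases j <;> simp [Matrix.mul_apply, Fin.sum_univ_two, h0, h1]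

theorem span_eq_top_iff_det (M : M2 L) : Ideal.span {M} = ⊤ ↔ M.det ≠ 0 := by
  rw [Ideal.eq_top_iff_one, Ideal.mem_span_singleton']
  constructor
  · rintro ⟨a, ha⟩ h
    have := congrArg Matrix.det ha
    simp [h] at this
  · intro h
    exact ⟨M⁻¹, Matrix.nonsing_inv_mul _ (isUnit_iff_ne_zero.2 h)⟩

theorem span_lt_top_iff_det (M : M2 L) : Ideal.span {M} < ⊤ ↔ M.det = 0 := by
  rw [lt_top_iff_ne_top, ne_eq, span_eq_top_iff_det, not_not]

theorem span_one_matrix : Ideal.span {(!![1, 0; 0, 1] : M2 L)} = ⊤ := by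
  rw [span_eq_top_iff_det]; simp

theorem span_zero_matrix : Ideal.span {(!![0, 0; 0, 0] : M2 L)} = ⊥ := by
  rw [Ideal.span_singleton_eq_bot]
  ext i j
  fin_cases i <;> fin_cases j <;> rfl

theorem eq_of_isRREF_of_span_eq {M N : M2 L} (hM : IsRREF M) (hN : IsRREF N)
    (h : Ideal.span {M} = Ideal.span {N}) : M = N := by
  have hMN : M ∈ Ideal.span {N} := h ▸ Ideal.mem_span_singleton_self M
  have hNM : N ∈ Ideal.span {M} := h.symm ▸ Ideal.mem_span_singleton_self N
  rcases hM with rfl | rfl | ⟨c, rfl⟩ | rfl <;> rcases hN with rfl | rfl | ⟨d, rfl⟩ | rfl <;>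
    simp [mem_span_one_row, mem_span_zero_one_row, span_one_matrix, span_zero_matrix,
      ← Matrix.ext_iff] at hMN hNM ⊢
  exact hNM.symm

/-- A left ideal consists of all matrices with rows in a fixed subspace of L². The cases are: an
invertible element exists; all elements are singular but some first column is nonzero; all first
columns vanish. -/
theorem exists_isRREF_span (I : Ideal (M2 L)) : ∃ M : M2 L, IsRREF M ∧ I = Ideal.span {M} := by
  by_cases hdet : ∃ X ∈ I, X.det ≠ 0
  · obtain ⟨X, hX, hd⟩ := hdet
    refine ⟨_, Or.inr (Or.inr (Or.inr rfl)), ?_⟩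
    rw [span_one_matrix, eq_top_iff, ← (span_eq_top_iff_det X).2 hd]
    exact (Ideal.span_singleton_le_iff_mem I).2 hX
  push Not at hdet
  by_cases hcol : ∃ X ∈ I, ∃ i, X i 0 ≠ 0
  · obtain ⟨X, hX, i, hi⟩ := hcol
    have hE : (!![1, (X i 0)⁻¹ * X i 1; 0, 0] : M2 L) ∈ I := by
      have := I.mul_mem_left (Matrix.single 0 i (X i 0)⁻¹ : M2 L) hX
      convert this using 1
      ext a b
      fin_cases a <;> fin_cases b <;> simp [hi]
    refine ⟨_, Or.inr (Or.inr (Or.inl ⟨_, rfl⟩)), le_antisymm ?_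
      ((Ideal.span_singleton_le_iff_mem I).2 hE)⟩
    intro Y hY
    have key : ∀ j, Y j 1 = Y j 0 * ((X i 0)⁻¹ * X i 1) := by
      intro j
      -- This puts row `j` of `Y` below the row (1, c) already found; singularity of the sum makes
      -- the two rows proportional.
      have h1 := I.mul_mem_left (Matrix.single 1 j 1 : M2 L) hY
      have h2 := hdet _ (I.add_mem hE h1)
      rw [Matrix.det_fin_two] at h2
      simp at h2
      linear_combination h2
    exact (mem_span_one_row _ _).2 ⟨key 0, key 1⟩
  push Not at hcol
  by_cases hI : ∃ X ∈ I, ∃ i, X i 1 ≠ 0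
  · obtain ⟨X, hX, i, hi⟩ := hI
    have hE : (!![0, 1; 0, 0] : M2 L) ∈ I := by
      have := I.mul_mem_left (Matrix.single 0 i (X i 1)⁻¹ : M2 L) hX
      convert this using 1
      ext a b
      fin_cases a <;> fin_cases b <;> simp [hi, hcol X hX]
    refine ⟨_, Or.inr (Or.inl rfl), le_antisymm ?_ ((Ideal.span_singleton_le_iff_mem I).2 hE)⟩
    intro Y hY
    exact (mem_span_zero_one_row _).2 ⟨hcol Y hY 0, hcol Y hY 1⟩
  · push Not at hI
    refine ⟨_, Or.inl rfl, ?_⟩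
    rw [span_zero_matrix, eq_bot_iff]
    intro X hX
    rw [Submodule.mem_bot]
    ext a b
    fin_cases b
    · exact hcol X hX a
    · exact hI X hX a

theorem hasNormalGenerators_isRREF (L : Type*) [Field L] :
    HasNormalGenerators (M2 L) IsRREF := by
  intro I
  obtain ⟨M, hM, rfl⟩ := exists_isRREF_span I
  exact ⟨M, ⟨hM, rfl⟩, fun N hN => (eq_of_isRREF_of_span_eq hM hN.1 hN.2).symm⟩

/-! ### Isotropic matrices in row reduced echelon form -/

theorem of_fin_two_eq_zero_iff (a b c d : L) :
    (!![a, b; c, d] : M2 L) = 0 ↔ a = 0 ∧ b = 0 ∧ c = 0 ∧ d = 0 := by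
  simp [← Matrix.ext_iff, and_assoc]

/-- The form takes the value 2(1 + wc + c²) on the row (1, c) and 2 on (0, 1), so no nonzero row is
isotropic. -/
theorem mul_mul_transpose_eq_zero_iff_of_anisotropic (h2 : (2 : L) ≠ 0) {w : L}
    (hw : ∀ c : L, 1 + w * c + c ^ 2 ≠ 0) {M : M2 L} (hM : IsRREF M) :
    M * !![2, w; w, 2] * M.transpose = 0 ↔ Ideal.span {M} = ⊥ := by
  rw [Ideal.span_singleton_eq_bot]
  rcases hM with rfl | rfl | ⟨c, rfl⟩ | rfl <;>
    simp only [transpose_of_fin_two, Matrix.mul_fin_two, of_fin_two_eq_zero_iff]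
  · simp
  · simp [h2]
  · have : 2 * (1 + w * c + c ^ 2) ≠ 0 := mul_ne_zero h2 (hw c)
    simp only [one_ne_zero, false_and, iff_false]
    rintro ⟨h, -⟩
    apply this
    linear_combination h
  · simp [h2]

/-- The row (1, c) has value 2c, so besides (0, 1) only (1, 0) is isotropic; the identity fails
because the form is nonzero. -/
theorem mul_mul_transpose_eq_zero_iff_of_hyperbolic (h2 : (2 : L) ≠ 0) {M : M2 L}
    (hM : IsRREF M) : M * !![0, 1; 1, 0] * M.transpose = 0 ↔
      M = !![0, 0; 0, 0] ∨ M = !![0, 1; 0, 0] ∨ M = !![1, 0; 0, 0] := by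
  rcases hM with rfl | rfl | ⟨c, rfl⟩ | rfl <;>
    simp only [transpose_of_fin_two, Matrix.mul_fin_two, of_fin_two_eq_zero_iff] <;>
    simp
  constructor
  · intro h
    refine (mul_eq_zero.1 (?_ : 2 * c = 0)).resolve_left h2
    linear_combination h
  · rintro rfl
    simp

theorem mul_mul_transpose_symplectic (M : M2 L) :
    M * !![0, 1; -1, 0] * M.transpose = M.det • !![0, 1; -1, 0] := by
  ext i j
  fin_cases i <;> fin_cases j <;>
    simp [Matrix.mul_apply, Fin.sum_univ_two, Matrix.det_fin_two] <;> ring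

theorem mul_mul_transpose_eq_zero_iff_of_symplectic (M : M2 L) :
    M * !![0, 1; -1, 0] * M.transpose = 0 ↔ Ideal.span {M} < ⊤ := by
  rw [mul_mul_transpose_symplectic, span_lt_top_iff_det]
  simp [← Matrix.ext_iff]

end MatrixIdeals

/-! ### Componentwise generators as a single generator of the product algebra. -/

section SumSpan

variable {F K : Type*} [Field F] [Field K] [Algebra F K] {r s t k : ℕ} {α β : ℕ → K} {ι : K}

theorem sumSpan_eq_span (M : AlgA F r s α) (N : AlgB F t k β ι) :
    sumSpan M N = (Ideal.span {(M, N)} : Ideal (AlgA F r s α × AlgB F t k β ι)) := by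
  ext x
  simp only [sumSpan, Set.mem_ofPred_eq, SetLike.mem_coe, mem_span_singleton_prod (R := AlgA F r s α),
    mem_span_singleton_prod (R := F × F), mem_span_singleton_prod (R := F⟮ι⟯),
    mem_span_singleton_prod (R := ∀ _ : Finset.Icc 2 r, _),
    mem_span_singleton_prod (R := ∀ _ : Finset.Icc 2 t, _),
    mem_span_singleton_pi, and_assoc]

theorem hasNormalGenerators_allRREF :
    HasNormalGenerators (AlgA F r s α × AlgB F t k β ι) (fun x => AllRREF x.1 x.2) := by
  have h := (((hasNormalGenerators_field F).prod (hasNormalGenerators_field F)).prod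
    ((HasNormalGenerators.pi fun i : Finset.Icc 2 r =>
        hasNormalGenerators_isRREF F⟮α i + (α i)⁻¹⟯).prod
      (HasNormalGenerators.pi fun i : Finset.Icc (r + 1) (r + s) =>
        hasNormalGenerators_isRREF F⟮α i⟯))).prod
    ((hasNormalGenerators_field F⟮ι⟯).prod
    ((HasNormalGenerators.pi fun j : Finset.Icc 2 t =>
        hasNormalGenerators_isRREF F⟮β j + (β j)⁻¹⟯).prod
      (HasNormalGenerators.pi fun j : Finset.Icc (t + 1) (t + k) =>
        hasNormalGenerators_isRREF F⟮β j⟯)))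
  convert h using 2 with x
  refine ⟨fun hx => ⟨⟨hx.A_one, hx.A_self, hx.A_pair⟩, hx.B_one, hx.B_self, hx.B_pair⟩, ?_⟩
  rintro ⟨⟨h1, h2, h3⟩, h4, h5, h6⟩
  exact ⟨h1, h2, h3, h4, h5, h6⟩

end SumSpan

/-! ### The involution of a group algebra -/

section Involution

variable {F G : Type*} [Field F] [Group G]

/-- The anti-automorphism of `F[G]` which inverts the elements of `G`. -/
noncomputable def bar : MonoidAlgebra F G →ₐ[F] (MonoidAlgebra F G)ᵐᵒᵖ :=
  MonoidAlgebra.lift F _ G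
    { toFun := fun g => MulOpposite.op (MonoidAlgebra.of F G g⁻¹)
      map_one' := by simp only [inv_one, map_one, MulOpposite.op_one]
      map_mul' := fun g h => by rw [mul_inv_rev, map_mul, MulOpposite.op_mul] }

/-- The image of `x` under the anti-automorphism which inverts the elements of `G`. -/
noncomputable def conj (x : MonoidAlgebra F G) : MonoidAlgebra F G := (bar x).unop

theorem conj_mul (x y : MonoidAlgebra F G) : conj (x * y) = conj y * conj x := by
  simp [conj]

theorem conj_add (x y : MonoidAlgebra F G) : conj (x + y) = conj x + conj y := by
  simp [conj]

theorem conj_zero : conj (0 : MonoidAlgebra F G) = 0 := by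
  simp [conj]

theorem conj_single (g : G) (c : F) :
    conj (MonoidAlgebra.single g c) = MonoidAlgebra.single g⁻¹ c := by
  simp [conj, bar]

/-- Both sides equal ∑ x_{hg} y_g over g. Thus one product in the group algebra records the inner
products of `x` with all translates of `y`. -/
theorem coeff_mul_conj [Fintype G] (x y : MonoidAlgebra F G) (h : G) :
    (x * conj y).coeff h = euclideanInner x (MonoidAlgebra.single h 1 * y) := by
  induction y using MonoidAlgebra.induction_linear with
  | zero => simp [conj_zero, euclideanInner]
  | add y z hy hz =>
    simp only [conj_add, mul_add, MonoidAlgebra.coeff_add, Finsupp.add_apply, hy, hz,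
      euclideanInner, Finset.sum_add_distrib]
  | single g c =>
    classical
    rw [conj_single, MonoidAlgebra.coeff_mul_single_eq_coeff_mul (h * g)
      (fun m _ => by rw [mul_inv_eq_iff_eq_mul])]
    simp [euclideanInner, Finsupp.single_apply]

/-- The coefficients of m · conj m are inner products of m with its translates, which lie in the
ideal. Conversely (am) · conj(bm) = a (m · conj m) conj b, and its coefficient at 1 is (am | bm). -/
theorem isSelfOrthogonal_span_iff [Fintype G] (m : MonoidAlgebra F G) :
    IsSelfOrthogonal (Ideal.span {m}) ↔ m * conj m = 0 := by
  constructor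
  · intro h
    have hm := Ideal.mem_span_singleton_self m
    ext g
    rw [coeff_mul_conj]
    exact h (Ideal.mul_mem_left _ _ hm) m hm
  · intro h y hy x hx
    obtain ⟨a, rfl⟩ := Ideal.mem_span_singleton'.1 hx
    obtain ⟨b, rfl⟩ := Ideal.mem_span_singleton'.1 hy
    have := coeff_mul_conj (a * m) (b * m) 1
    rw [← MonoidAlgebra.one_def, one_mul, conj_mul, mul_assoc a, ← mul_assoc m, h, zero_mul,
      mul_zero] at this
    exact this.symm

/-- Group elements act as isometries of `S`, so φ(g⁻¹) is the adjoint of φ(g); by linearity `conj`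
becomes the adjoint for `S`. -/
theorem map_mul_conj_mul_form {L : Type*} [Field L] [Algebra F L]
    (φ : MonoidAlgebra F G →ₐ[F] M2 L) (S : M2 L)
    (hS : ∀ g, φ (.of F G g) * S * (φ (.of F G g)).transpose = S) (x y : MonoidAlgebra F G) :
    φ (x * conj y) * S = φ x * S * (φ y).transpose := by
  induction y using MonoidAlgebra.induction_linear with
  | zero => simp [conj_zero]
  | add y z hy hz => simp only [conj_add, mul_add, map_add, add_mul, hy, hz, Matrix.transpose_add]
  | single g c =>
    have e : ∀ h : G, (MonoidAlgebra.single h c : MonoidAlgebra F G) = c • .of F G h := by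
      intro h; simp
    have h1 : φ (.of F G g⁻¹) * φ (.of F G g) = 1 := by
      rw [← map_mul, ← map_mul, inv_mul_cancel, map_one, map_one]
    have h2 : φ (.of F G g⁻¹) * S = S * (φ (.of F G g)).transpose := by
      conv_lhs => rw [← hS g, ← mul_assoc, ← mul_assoc, h1, one_mul]
    rw [conj_single, e, e, map_mul, map_smul, map_smul, Matrix.transpose_smul, mul_smul_comm,
      mul_smul_comm, smul_mul_assoc, mul_assoc, h2, mul_assoc]

/-- The q-th power map is an F-algebra endomorphism of `L`, so agreement on group elements suffices.
-/
theorem map_conj_eq_pow [Fintype F] {L : Type*} [Field L] [Algebra F L]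
    (φ : MonoidAlgebra F G →ₐ[F] L)
    (h : ∀ g, φ (.of F G g⁻¹) = φ (.of F G g) ^ Fintype.card F) (y : MonoidAlgebra F G) :
    φ (conj y) = φ y ^ Fintype.card F := by
  have hfrob : ∀ z : L, z ^ Fintype.card F = FiniteField.frobeniusAlgHom F L z := fun z => rfl
  induction y using MonoidAlgebra.induction_linear with
  | zero => simp [conj_zero]
  | add y z hy hz => rw [conj_add, map_add, hy, hz, map_add, hfrob, hfrob, hfrob, map_add]
  | single g c =>
    have e : ∀ h : G, (MonoidAlgebra.single h c : MonoidAlgebra F G) = c • .of F G h := by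
      intro h; simp
    rw [conj_single, e, e, map_smul, map_smul, h, hfrob, hfrob, map_smul]

end Involution

/-! ### The group algebra of the generalised quaternion group -/

section Quaternion

variable {n : ℕ}

theorem a_eq_pow [NeZero n] (i : ZMod (2 * n)) :
    QuaternionGroup.a i = (QuaternionGroup.a 1 : QuaternionGroup n) ^ i.val := by
  rw [QuaternionGroup.a_one_pow, ZMod.natCast_zmod_val]

theorem xa_eq_mul_pow [NeZero n] (i : ZMod (2 * n)) :
    QuaternionGroup.xa i =
      (QuaternionGroup.xa 0 : QuaternionGroup n) * QuaternionGroup.a 1 ^ i.val := by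
  rw [← a_eq_pow, QuaternionGroup.xa_mul_a, zero_add]

theorem quaternionGroup_induction [NeZero n] {p : QuaternionGroup n → Prop} (one : p 1)
    (mul : ∀ g h, p g → p h → p (g * h)) (ha : p (QuaternionGroup.a 1))
    (hb : p (QuaternionGroup.xa 0)) (g : QuaternionGroup n) : p g := by
  have hpow : ∀ k : ℕ, p (QuaternionGroup.a 1 ^ k) := by
    intro k
    induction k with
    | zero => simpa using one
    | succ k ih => rw [pow_succ]; exact mul _ _ ih ha
  cases g with
  | a i => rw [a_eq_pow]; exact hpow _
  | xa i => rw [xa_eq_mul_pow]; exact mul _ _ hb (hpow _)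

/-- The relations satisfied by the generators `a`, `b` of `Q_n`. -/
structure QuatRelations (n : ℕ) {R : Type*} [Monoid R] (A B : R) : Prop where
  pow_two_mul : A ^ (2 * n) = 1
  mul_self : B * B = A ^ n
  -- Form of b⁻¹ab = a⁻¹ without inverses, meaningful in any monoid.
  mul_mul : A * B * A = B

namespace QuatRelations

variable {R : Type*} [Monoid R] {A B : R}

theorem pow_val_add [NeZero n] (h : QuatRelations n A B) (i j : ZMod (2 * n)) :
    A ^ (i + j).val = A ^ i.val * A ^ j.val := by
  rw [ZMod.val_add, ← pow_add, ← pow_eq_pow_mod _ h.pow_two_mul]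

theorem pow_mul_mul_pow (h : QuatRelations n A B) (k : ℕ) : A ^ k * B * A ^ k = B := by
  induction k with
  | zero => simp
  | succ k ih =>
    calc A ^ (k + 1) * B * A ^ (k + 1) = (A ^ k * A) * B * (A * A ^ k) := by
          rw [← pow_succ, ← pow_succ']
      _ = A ^ k * (A * B * A) * A ^ k := by simp only [mul_assoc]
      _ = B := by rw [h.mul_mul, ih]

theorem pow_val_mul_mul [NeZero n] (h : QuatRelations n A B) (i j : ZMod (2 * n)) :
    A ^ i.val * B * A ^ j.val = B * A ^ (j - i).val := by
  have : j = i + (j - i) := by ring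
  conv_lhs => rw [this, h.pow_val_add, ← mul_assoc, h.pow_mul_mul_pow]

/-- The homomorphism from `Q_n` determined by the images of the generators. -/
def lift [NeZero n] (h : QuatRelations n A B) : QuaternionGroup n →* R where
  toFun
    | .a i => A ^ i.val
    | .xa i => B * A ^ i.val
  map_one' := by
    rw [QuaternionGroup.one_def]
    simp
  map_mul' := by
    rintro (i | i) (j | j)
    · rw [QuaternionGroup.a_mul_a]
      exact h.pow_val_add i j
    · rw [QuaternionGroup.a_mul_xa]
      simp only
      rw [← mul_assoc, h.pow_val_mul_mul]
    · rw [QuaternionGroup.xa_mul_a]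
      simp only
      rw [h.pow_val_add, mul_assoc]
    · rw [QuaternionGroup.xa_mul_xa]
      simp only
      rw [mul_assoc B, ← mul_assoc _ B, h.pow_val_mul_mul, ← mul_assoc, h.mul_self,
        add_sub_assoc, h.pow_val_add, ZMod.val_natCast, ← pow_eq_pow_mod _ h.pow_two_mul]

theorem lift_a_one [NeZero n] (h : QuatRelations n A B) : h.lift (QuaternionGroup.a 1) = A := by
  have h2 : Fact (1 < 2 * n) := ⟨by have := NeZero.pos n; omega⟩
  change A ^ (1 : ZMod (2 * n)).val = A
  rw [ZMod.val_one, pow_one]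

theorem lift_xa_zero [NeZero n] (h : QuatRelations n A B) : h.lift (QuaternionGroup.xa 0) = B := by
  change B * A ^ (0 : ZMod (2 * n)).val = B
  rw [ZMod.val_zero, pow_zero, mul_one]

theorem prod {S : Type*} [Monoid S] {A B : R × S} (h₁ : QuatRelations n A.1 B.1)
    (h₂ : QuatRelations n A.2 B.2) : QuatRelations n A B :=
  ⟨Prod.ext h₁.1 h₂.1, Prod.ext h₁.2 h₂.2, Prod.ext h₁.3 h₂.3⟩

theorem pi {ι : Type*} {S : ι → Type*} [∀ i, Monoid (S i)] {A B : ∀ i, S i}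
    (h : ∀ i, QuatRelations n (A i) (B i)) : QuatRelations n A B :=
  ⟨funext fun i => (h i).1, funext fun i => (h i).2, funext fun i => (h i).3⟩

/-- Allows the relations over `L` to be checked over `K`, where the matrices become diagonal and
antidiagonal. -/
theorem of_injective {S : Type*} [Monoid S] (f : R →* S) (hf : Function.Injective f)
    (h : QuatRelations n (f A) (f B)) : QuatRelations n A B := by
  refine ⟨hf ?_, hf ?_, hf ?_⟩ <;> simp only [map_mul, map_pow, map_one]
  exacts [h.1, h.2, h.3]

theorem map {S : Type*} [Monoid S] (f : R →* S) (h : QuatRelations n A B) :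
    QuatRelations n (f A) (f B) := by
  refine ⟨?_, ?_, ?_⟩ <;> simp only [← map_mul, ← map_pow, ← map_one f]
  exacts [congrArg f h.1, congrArg f h.2, congrArg f h.3]

end QuatRelations

/-- The normal form on which injectivity of ψ is tested. -/
theorem exists_polynomial_form [NeZero n] {F : Type*} [Field F] (x : MonoidAlgebra F (QuaternionGroup n)) :
    ∃ P Q : F[X], x = aeval (MonoidAlgebra.of F (QuaternionGroup n) (QuaternionGroup.a 1)) P +
      MonoidAlgebra.of F _ (QuaternionGroup.xa 0) *
        aeval (MonoidAlgebra.of F (QuaternionGroup n) (QuaternionGroup.a 1)) Q := by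
  induction x using MonoidAlgebra.induction_linear with
  | zero => exact ⟨0, 0, by simp⟩
  | add x y hx hy =>
    obtain ⟨P, Q, hx⟩ := hx
    obtain ⟨P', Q', hy⟩ := hy
    refine ⟨P + P', Q + Q', ?_⟩
    rw [hx, hy, map_add, map_add, mul_add]
    abel
  | single g c =>
    have e : (MonoidAlgebra.single g c : MonoidAlgebra F (QuaternionGroup n)) =
      c • .of F _ g := by simp
    cases g with
    | a i =>
      refine ⟨C c * X ^ i.val, 0, ?_⟩
      rw [e, a_eq_pow, map_pow, map_zero, mul_zero, add_zero, map_mul, map_pow, aeval_X, aeval_C,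
        Algebra.smul_def]
    | xa i =>
      refine ⟨0, C c * X ^ i.val, ?_⟩
      rw [e, xa_eq_mul_pow, map_mul, map_pow, map_zero, zero_add, map_mul, map_pow, aeval_X,
        aeval_C, ← Algebra.smul_def, mul_smul_comm]

theorem aeval_a_one_eq_zero {F : Type*} [Field F] {P : F[X]} (h : X ^ (2 * n) - 1 ∣ P) :
    aeval (MonoidAlgebra.of F (QuaternionGroup n) (QuaternionGroup.a 1)) P = 0 := by
  obtain ⟨R, rfl⟩ := h
  rw [map_mul, map_sub, map_pow, aeval_X, map_one, ← map_pow, QuaternionGroup.a_one_pow_n, map_one,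
    sub_self, zero_mul]

end Quaternion

/-! ### Finite fields generated by reciprocal pairs -/

section Fields

variable {F K : Type*} [Field F] [Field K] [Algebra F K]

theorem natCast_ne_zero_of_coprime_card [Fintype F] {m : ℕ} (h : Nat.Coprime (Fintype.card F) m) :
    (m : F) ≠ 0 := by
  obtain ⟨p, hp⟩ := CharP.exists F
  obtain ⟨k, hk, hc⟩ := FiniteField.card F p
  rw [ne_eq, CharP.cast_eq_zero_iff F p]
  intro hd
  have h1 : p ∣ Fintype.card F := hc ▸ dvd_pow_self p k.ne_zero
  exact hk.one_lt.ne' (Nat.dvd_one.1 (h ▸ Nat.dvd_gcd h1 hd))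

section Reciprocal

variable {g : F[X]} {β : K}

/-- The embedding of F(β) sending β to its conjugate β⁻¹ fixes every polynomial in β + β⁻¹, but
moves β since β² ≠ 1. -/
theorem notMem_adjoin_add_inv (hm : g.Monic) (hg : Irreducible g) (hβ : aeval β g = 0)
    (hβ' : aeval β⁻¹ g = 0) (h0 : β ≠ 0) (h1 : β ^ 2 ≠ 1) : β ∉ F⟮β + β⁻¹⟯ := by
  have hmin : g = minpoly F β := minpoly.eq_of_irreducible_of_monic hg hβ hm
  have hint : IsIntegral F β := ⟨g, hm, hβ⟩
  obtain ⟨σ, hσ⟩ : ∃ σ : F⟮β⟯ →ₐ[F] K, σ (IntermediateField.AdjoinSimple.gen F β) = β⁻¹ :=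
    ⟨_, IntermediateField.algHomAdjoinIntegralEquiv_symm_apply_gen F hint
      ⟨β⁻¹, by rw [mem_aroots, ← hmin]; exact ⟨hg.ne_zero, hβ'⟩⟩⟩
  intro hmem
  have hint' : IsIntegral F (β + β⁻¹) := hint.add hint.inv
  rw [← IntermediateField.mem_toSubalgebra,
    IntermediateField.adjoin_simple_toSubalgebra_of_isAlgebraic hint'.isAlgebraic,
    Algebra.adjoin_singleton_eq_range_aeval] at hmem
  obtain ⟨P, hP⟩ := hmem
  replace hP : aeval (β + β⁻¹) P = β := hP
  set x := IntermediateField.AdjoinSimple.gen F β with hx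
  have hxβ : F⟮β⟯.val x = β := IntermediateField.AdjoinSimple.coe_gen F β
  have e : aeval (x + x⁻¹) P = x := by
    apply Subtype.val_injective
    change F⟮β⟯.val _ = F⟮β⟯.val x
    rw [← aeval_algHom_apply, map_add, map_inv₀, hxβ, hP]
  have e2 := congrArg σ e
  rw [← aeval_algHom_apply, map_add, map_inv₀, hσ, inv_inv, add_comm, hP] at e2
  apply h1
  rw [sq]
  nth_rw 1 [e2]
  exact inv_mul_cancel₀ h0

theorem aeval_quadratic (h0 : β ≠ 0) : β ^ 2 - (β + β⁻¹) * β + 1 = 0 := by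
  field_simp
  ring

theorem finrank_adjoin_simple_eq (hm : g.Monic) (hg : Irreducible g) (hβ : aeval β g = 0) :
    Module.finrank F F⟮β⟯ = g.natDegree := by
  rw [IntermediateField.adjoin.finrank ⟨g, hm, hβ⟩,
    ← minpoly.eq_of_irreducible_of_monic hg hβ hm]

/-- Tower law: with w = β + β⁻¹, β is a root of X² - wX + 1 and not in F(w), so F(β) is quadratic
over F(w). -/
theorem finrank_adjoin_add_inv (hm : g.Monic) (hg : Irreducible g) (hβ : aeval β g = 0)
    (hβ' : aeval β⁻¹ g = 0) (h0 : β ≠ 0) (h1 : β ^ 2 ≠ 1) :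
    2 * Module.finrank F F⟮β + β⁻¹⟯ = g.natDegree := by
  have hnm := notMem_adjoin_add_inv hm hg hβ hβ' h0 h1
  obtain ⟨w, hw⟩ : ∃ w, w = β + β⁻¹ := ⟨_, rfl⟩
  rw [← hw] at hnm ⊢
  let W : F⟮w⟯ := ⟨w, IntermediateField.mem_adjoin_simple_self F w⟩
  have hqm : (X ^ 2 - C W * X + 1 : F⟮w⟯[X]).Monic := by monicity!
  have hqd : (X ^ 2 - C W * X + 1 : F⟮w⟯[X]).natDegree = 2 := by compute_degree!
  have hq : aeval β (X ^ 2 - C W * X + 1 : F⟮w⟯[X]) = 0 := by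
    simpa [W, hw] using aeval_quadratic h0
  have hint : IsIntegral F⟮w⟯ β := ⟨_, hqm, hq⟩
  have hd : (minpoly F⟮w⟯ β).natDegree = 2 := by
    have h2 : (minpoly F⟮w⟯ β).natDegree ≤ 2 :=
      hqd ▸ natDegree_le_of_dvd (minpoly.dvd F⟮w⟯ β hq) hqm.ne_zero
    have h3 := minpoly.natDegree_pos hint
    have h4 : (minpoly F⟮w⟯ β).natDegree ≠ 1 := by
      rw [ne_eq, minpoly.natDegree_eq_one_iff]
      rintro ⟨y, rfl⟩
      exact hnm y.2
    omega
  have hfr := IntermediateField.adjoin.finrank hint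
  rw [hd] at hfr
  have hEq : (F⟮w⟯⟮β⟯).restrictScalars F = F⟮β⟯ := by
    rw [IntermediateField.adjoin_simple_adjoin_simple]
    apply le_antisymm
    · rw [IntermediateField.adjoin_le_iff]
      rintro x (rfl | rfl)
      · rw [hw]
        have := IntermediateField.mem_adjoin_simple_self F β
        exact add_mem this (inv_mem this)
      · exact IntermediateField.mem_adjoin_simple_self F x
    · rw [IntermediateField.adjoin_simple_le_iff]
      exact IntermediateField.subset_adjoin F _ (by simp)
  have hmul := Module.finrank_mul_finrank F F⟮w⟯ F⟮w⟯⟮β⟯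
  have h5 : Module.finrank F F⟮w⟯⟮β⟯ = Module.finrank F ((F⟮w⟯⟮β⟯).restrictScalars F) := rfl
  rw [h5, hEq, hfr, finrank_adjoin_simple_eq hm hg hβ] at hmul
  omega

theorem inv_ne_self (h0 : β ≠ 0) (h1 : β ^ 2 ≠ 1) : β - β⁻¹ ≠ 0 := by
  intro h
  apply h1
  rw [sub_eq_zero] at h
  rw [sq]
  nth_rw 1 [h]
  exact inv_mul_cancel₀ h0

/-- The expression factors as (c + β)(c + β⁻¹), and either zero would put β in `L`. This is the
anisotropy of the norm form. -/
theorem one_add_mul_add_sq_ne_zero (L : IntermediateField F K) (w : L) (hw : (w : K) = β + β⁻¹)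
    (h0 : β ≠ 0) (hβ : β ∉ L) (c : L) : 1 + w * c + c ^ 2 ≠ 0 := by
  intro h
  have h' := congrArg (fun z : L => (z : K)) h
  simp only [IntermediateField.coe_add, IntermediateField.coe_mul, IntermediateField.coe_one,
    IntermediateField.coe_pow, IntermediateField.coe_zero, hw] at h'
  have : ((c : K) + β) * (c + β⁻¹) = 0 := by
    rw [← h']
    field_simp
    ring
  apply hβ
  rcases mul_eq_zero.1 this with h | h
  · rw [eq_neg_of_add_eq_zero_right h]
    exact neg_mem c.2
  · rw [← inv_inv β, eq_neg_of_add_eq_zero_right h]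
    exact inv_mem (neg_mem c.2)

end Reciprocal

/-! ### Membership in a finite subfield via Frobenius; the role of q ≡ 3 mod 4. -/

section Frobenius

/-- The elements of `L` already exhaust the roots of X^|L| - X. -/
theorem mem_of_pow_card_eq (L : IntermediateField F K) [Finite L] {x : K}
    (hx : x ^ Nat.card L = x) : x ∈ L := by
  have := Fintype.ofFinite L
  have hm : (X ^ Fintype.card L - X : L[X]).Monic :=
    monic_X_pow_sub (by rw [degree_X]; exact_mod_cast Fintype.one_lt_card)
  have h := prod_multiset_X_sub_C_of_monic_of_roots_card_eq hm (by
    rw [FiniteField.roots_X_pow_card_sub_X,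
      FiniteField.X_pow_card_sub_X_natDegree_eq L Fintype.one_lt_card]
    rfl)
  rw [FiniteField.roots_X_pow_card_sub_X] at h
  have h2 := congrArg (aeval x) h
  rw [map_sub, map_pow, aeval_X, Fintype.card_eq_nat_card, hx, sub_self] at h2
  change aeval x (∏ a : L, (X - C a)) = 0 at h2
  rw [map_prod, Finset.prod_eq_zero_iff] at h2
  obtain ⟨a, -, ha⟩ := h2
  rw [map_sub, aeval_X, aeval_C, sub_eq_zero] at ha
  rw [ha]
  exact a.2

theorem pow_card_add (L : IntermediateField F K) [Finite L] (x y : K) :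
    (x + y) ^ Nat.card L = x ^ Nat.card L + y ^ Nat.card L := by
  have := Fintype.ofFinite L
  rw [← Fintype.card_eq_nat_card]
  exact map_add (FiniteField.frobeniusAlgHom L K) x y

theorem pow_card_eq_self (L : IntermediateField F K) [Finite L] {x : K} (hx : x ∈ L) :
    x ^ Nat.card L = x := by
  have := Fintype.ofFinite L
  rw [← Fintype.card_eq_nat_card]
  exact congrArg (fun z : L => (z : K)) (FiniteField.pow_card (⟨x, hx⟩ : L))

variable {β ι : K}

/-- The Frobenius of `L` permutes the roots β, β⁻¹ of X² - (β + β⁻¹)X + 1 and does not fix β. -/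
theorem pow_card_eq_inv (L : IntermediateField F K) [Finite L] (h0 : β ≠ 0) (hβ : β ∉ L)
    (hw : β + β⁻¹ ∈ L) : β ^ Nat.card L = β⁻¹ := by
  have h := pow_card_add L β β⁻¹
  rw [pow_card_eq_self L hw, inv_pow] at h
  have h2 : β ^ Nat.card L ≠ β := fun h => hβ (mem_of_pow_card_eq L h)
  have hne : β ^ Nat.card L ≠ 0 := pow_ne_zero _ h0
  set γ := β ^ Nat.card L
  have : (γ - β) * (γ - β⁻¹) = 0 := by
    field_simp at h ⊢
    linear_combination -h
  rcases mul_eq_zero.1 this with h | h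
  · exact absurd (sub_eq_zero.1 h) h2
  · exact sub_eq_zero.1 h

theorem pow_of_mod_four_eq_one (hι : ι ^ 2 = -1) {N : ℕ} (hN : N % 4 = 1) : ι ^ N = ι := by
  have h4 : ι ^ 4 = 1 := by linear_combination (ι ^ 2 - 1) * hι
  rw [pow_eq_pow_mod N h4, hN, pow_one]

theorem pow_of_mod_four_eq_three (hι : ι ^ 2 = -1) {N : ℕ} (hN : N % 4 = 3) : ι ^ N = -ι := by
  have h4 : ι ^ 4 = 1 := by linear_combination (ι ^ 2 - 1) * hι
  rw [pow_eq_pow_mod N h4, hN]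
  linear_combination ι * hι

theorem pow_mod_four {q : ℕ} (hq : q % 4 = 3) (m : ℕ) :
    (Even m → q ^ m % 4 = 1) ∧ (¬ Even m → q ^ m % 4 = 3) := by
  induction m with
  | zero => simp
  | succ m ih =>
    rw [Nat.even_add_one, pow_succ, Nat.mul_mod, hq, not_not]
    constructor
    · intro h; rw [ih.2 h]
    · intro h; rw [ih.1 h]

/-- Here |L| ≡ 1 mod 4, so the Frobenius of `L` fixes √-1. -/
theorem mem_adjoin_of_even_finrank [Fintype F] (hq : Fintype.card F % 4 = 3) (hι : ι ^ 2 = -1)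
    (L : IntermediateField F K) [FiniteDimensional F L] (h : Even (Module.finrank F L)) :
    ι ∈ L := by
  have := Module.finite_of_finite F (M := L)
  refine mem_of_pow_card_eq L (pow_of_mod_four_eq_one hι ?_)
  rw [Module.natCard_eq_pow_finrank (K := F), Nat.card_eq_fintype_card]
  exact (pow_mod_four hq _).1 h

/-- Here |L| ≡ 3 mod 4, so the Frobenius of `L` changes the sign of both β - β⁻¹ and √-1. -/
theorem sub_inv_div_mem_of_odd_finrank [Fintype F] (hq : Fintype.card F % 4 = 3) (hι : ι ^ 2 = -1)
    (L : IntermediateField F K) [FiniteDimensional F L] (h : ¬ Even (Module.finrank F L))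
    (h0 : β ≠ 0) (hβ : β ∉ L) (hw : β + β⁻¹ ∈ L) : (β - β⁻¹) / ι ∈ L := by
  have := Module.finite_of_finite F (M := L)
  refine mem_of_pow_card_eq L ?_
  have hN : Nat.card L % 4 = 3 := by
    rw [Module.natCard_eq_pow_finrank (K := F), Nat.card_eq_fintype_card]
    exact (pow_mod_four hq _).2 h
  have hodd : Odd (Nat.card L) := Nat.odd_iff.2 (by omega)
  rw [div_pow, pow_of_mod_four_eq_three hι hN, sub_eq_add_neg, pow_card_add, hodd.neg_pow, inv_pow,
    pow_card_eq_inv L h0 hβ hw, inv_inv, ← sub_eq_add_neg, div_neg, ← neg_div, neg_sub, sub_eq_add_neg]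

theorem notMem_range_algebraMap [Fintype F] (hq : Fintype.card F % 4 = 3) (hι : ι ^ 2 = -1)
    (h2 : (2 : K) ≠ 0) (x : F) : algebraMap F K x ≠ ι := by
  rintro rfl
  have h := pow_of_mod_four_eq_three hι hq
  rw [← map_pow, FiniteField.pow_card] at h
  have h3 : algebraMap F K x = 0 := (mul_eq_zero.1 (by linear_combination h)).resolve_left h2
  rw [h3] at hι
  norm_num at hι

theorem finrank_adjoin_sqrt_neg_one [Fintype F] (hq : Fintype.card F % 4 = 3) (hι : ι ^ 2 = -1)
    (h2 : (2 : K) ≠ 0) : Module.finrank F F⟮ι⟯ = 2 := by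
  have hqm : (X ^ 2 + 1 : F[X]).Monic := by monicity!
  have hqd : (X ^ 2 + 1 : F[X]).natDegree = 2 := by compute_degree!
  have hr : aeval ι (X ^ 2 + 1 : F[X]) = 0 := by simp [hι]
  have hint : IsIntegral F ι := ⟨_, hqm, hr⟩
  rw [IntermediateField.adjoin.finrank hint]
  have h2 : (minpoly F ι).natDegree ≤ 2 :=
    hqd ▸ natDegree_le_of_dvd (minpoly.dvd F ι hr) hqm.ne_zero
  have h3 := minpoly.natDegree_pos hint
  have h4 : (minpoly F ι).natDegree ≠ 1 := by
    rw [ne_eq, minpoly.natDegree_eq_one_iff]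
    rintro ⟨y, hy⟩
    exact notMem_range_algebraMap hq hι ‹_› y hy
  omega

end Frobenius

end Fields

/-! ### Reciprocal factorisations of `X ^ n - C e` with `e ^ 2 = 1` -/

section Reciprocals

variable {F K : Type*} [Field F] [Field K] [Algebra F K] {g : F[X]} {β : K}

theorem trailingCoeff_eq_coeff_zero (h : g.coeff 0 ≠ 0) : g.trailingCoeff = g.coeff 0 := by
  rw [trailingCoeff, natTrailingDegree_eq_zero_of_constantCoeff_ne_zero h]

theorem recip_monic (h : g.coeff 0 ≠ 0) : (recip g).Monic := by
  rw [Monic, recip, leadingCoeff_mul, leadingCoeff_C, reverse_leadingCoeff,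
    trailingCoeff_eq_coeff_zero h, inv_mul_cancel₀ h]

theorem natDegree_recip (h : g.coeff 0 ≠ 0) : (recip g).natDegree = g.natDegree := by
  rw [recip, natDegree_C_mul (inv_ne_zero h), reverse_natDegree,
    natTrailingDegree_eq_zero_of_constantCoeff_ne_zero h, Nat.sub_zero]

theorem aeval_inv_recip (h0 : β ≠ 0) (hβ : aeval β g = 0) : aeval β⁻¹ (recip g) = 0 := by
  let _ := invertibleOfNonzero h0
  rw [recip, map_mul]
  refine mul_eq_zero_of_right _ ?_
  rw [← invOf_eq_inv]
  exact (eval₂_reverse_eq_zero_iff _ _ _).2 hβ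

theorem ne_zero_of_coeff_zero_ne_zero (h : g.coeff 0 ≠ 0) (hβ : aeval β g = 0) : β ≠ 0 := by
  rintro rfl
  rw [← coeff_zero_eq_aeval_zero', map_eq_zero] at hβ
  exact h hβ

theorem adjoin_inv (β : K) : F⟮β⁻¹⟯ = F⟮β⟯ := by
  apply le_antisymm <;> rw [IntermediateField.adjoin_simple_le_iff]
  · exact inv_mem (IntermediateField.mem_adjoin_simple_self F β)
  · have := inv_mem (IntermediateField.mem_adjoin_simple_self F β⁻¹)
    rwa [inv_inv] at this

/-- β and β⁻¹ generate the same field, so the minimal polynomial of β⁻¹ has the degree of its monic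
multiple `recip g`. -/
theorem minpoly_inv_eq_recip (hm : g.Monic) (hg : Irreducible g) (h : g.coeff 0 ≠ 0)
    (hβ : aeval β g = 0) : minpoly F β⁻¹ = recip g := by
  have h0 := ne_zero_of_coeff_zero_ne_zero h hβ
  have hint : IsIntegral F β⁻¹ := ⟨_, recip_monic h, aeval_inv_recip h0 hβ⟩
  refine (eq_of_monic_of_dvd_of_natDegree_le (minpoly.monic hint) (recip_monic h)
    (minpoly.dvd F _ (aeval_inv_recip h0 hβ)) ?_).symm
  rw [natDegree_recip h, ← IntermediateField.adjoin.finrank hint, adjoin_inv,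
    finrank_adjoin_simple_eq hm hg hβ]

end Reciprocals

namespace IsReciprocalFactorisation

variable {F : Type*} [Field F] {P l : F[X]} {r s : ℕ} {f : ℕ → F[X]}

theorem dvd (h : IsReciprocalFactorisation P l r s f) {i : ℕ} (hi : i ∈ Finset.Icc 1 (r + s)) :
    f i ∣ P := by
  rw [h.prod_eq]
  by_cases hir : i ≤ r
  · exact (Finset.dvd_prod_of_mem f
      (Finset.mem_Icc.2 ⟨(Finset.mem_Icc.1 hi).1, hir⟩)).mul_right _
  · have hi' : i ∈ Finset.Icc (r + 1) (r + s) :=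
      Finset.mem_Icc.2 ⟨by omega, (Finset.mem_Icc.1 hi).2⟩
    exact ((dvd_mul_right _ _).trans
      (Finset.dvd_prod_of_mem (fun i => f i * recip (f i)) hi')).mul_left _

theorem coeff_zero_ne_zero (h : IsReciprocalFactorisation P l r s f) (hP : P.coeff 0 ≠ 0) {i : ℕ}
    (hi : i ∈ Finset.Icc 1 (r + s)) : (f i).coeff 0 ≠ 0 := by
  obtain ⟨R, hR⟩ := h.dvd hi
  rw [hR, mul_coeff_zero] at hP
  exact left_ne_zero_of_mul hP

/-- Pairwise coprimality of the factors is not needed: the product of the r + 2s factors divides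
R^(r + 2s), and a squarefree divisor of a power divides the base. -/
theorem dvd_of_forall_dvd (h : IsReciprocalFactorisation P l r s f) (hP : Squarefree P) {R : F[X]}
    (h1 : ∀ i ∈ Finset.Icc 1 (r + s), f i ∣ R)
    (h2 : ∀ i ∈ Finset.Icc (r + 1) (r + s), recip (f i) ∣ R) : P ∣ R := by
  rw [← hP.dvd_pow_iff_dvd (n := r + 2 * s) (by have := h.one_le; omega), h.prod_eq, pow_add,
    pow_mul, sq]
  apply mul_dvd_mul
  · refine (Finset.prod_dvd_prod_of_dvd _ (fun _ => R) fun i hi => h1 i ?_).trans ?_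
    · rw [Finset.mem_Icc] at hi ⊢
      omega
    · simp
  · refine (Finset.prod_dvd_prod_of_dvd _ (fun _ => R * R) fun i hi =>
      mul_dvd_mul (h1 i ?_) (h2 i hi)).trans ?_
    · rw [Finset.mem_Icc] at hi ⊢
      omega
    · simp

theorem ne_first (h : IsReciprocalFactorisation P l r s f) (hP : Squarefree P) {i : ℕ}
    (hi : i ∈ Finset.Icc 2 r) : f i ≠ l := by
  intro he
  rw [Finset.mem_Icc] at hi
  have h1 : 1 ∈ Finset.Icc 1 r := Finset.mem_Icc.2 ⟨le_rfl, h.one_le⟩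
  have hi' : i ∈ (Finset.Icc 1 r).erase 1 := by
    rw [Finset.mem_erase, Finset.mem_Icc]
    omega
  have hd : l * l ∣ P := by
    rw [h.prod_eq, ← Finset.mul_prod_erase _ _ h1, ← Finset.mul_prod_erase _ _ hi', h.first, he,
      ← mul_assoc l l]
    exact (dvd_mul_right _ _).mul_right _
  have hl := h.irreducible 1 (Finset.mem_Icc.2 ⟨le_rfl, by have := h.one_le; omega⟩)
  rw [h.first] at hl
  exact hl.not_isUnit (hP _ hd)

theorem natDegree_eq (h : IsReciprocalFactorisation P l r s f) (hP : P.coeff 0 ≠ 0) :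
    P.natDegree = l.natDegree + ∑ i ∈ Finset.Icc 2 r, (f i).natDegree +
      ∑ i ∈ Finset.Icc (r + 1) (r + s), 2 * (f i).natDegree := by
  have hI : ∀ i ∈ Finset.Icc 1 r, i ∈ Finset.Icc 1 (r + s) := by
    intro i hi
    rw [Finset.mem_Icc] at hi ⊢
    omega
  have hI' : ∀ i ∈ Finset.Icc (r + 1) (r + s), i ∈ Finset.Icc 1 (r + s) := by
    intro i hi
    rw [Finset.mem_Icc] at hi ⊢
    omega
  have hm : ∀ i ∈ Finset.Icc (r + 1) (r + s), (f i * recip (f i)).Monic := fun i hi =>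
    (h.monic i (hI' i hi)).mul (recip_monic (h.coeff_zero_ne_zero hP (hI' i hi)))
  have hins : Finset.Icc 1 r = insert 1 (Finset.Icc 2 r) := by
    ext i
    have := h.one_le
    simp only [Finset.mem_insert, Finset.mem_Icc]
    omega
  conv_lhs => rw [h.prod_eq]
  rw [Monic.natDegree_mul (monic_prod_of_monic _ _ fun i hi => h.monic i (hI i hi))
      (monic_prod_of_monic _ _ hm), natDegree_prod_of_monic _ _ fun i hi => h.monic i (hI i hi),
    natDegree_prod_of_monic _ _ hm, hins, Finset.sum_insert (by simp), h.first]
  congr 1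
  refine Finset.sum_congr rfl fun i hi => ?_
  rw [(h.monic i (hI' i hi)).natDegree_mul (recip_monic (h.coeff_zero_ne_zero hP (hI' i hi))),
    natDegree_recip (h.coeff_zero_ne_zero hP (hI' i hi)), two_mul]

end IsReciprocalFactorisation

/-- The data of a reciprocal factorisation of `X ^ n - C e`, `e ^ 2 = 1`, with a choice of a root
of each factor. -/
structure RootedFactorisation {F K : Type*} [Field F] [Field K] [Algebra F K]
    (n : ℕ) (e : F) (r s : ℕ) (f : ℕ → F[X]) (α : ℕ → K) : Prop where
  odd : Odd n
  sq_eq_one : e ^ 2 = 1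
  natCast_ne_zero : (n : F) ≠ 0
  fact : IsReciprocalFactorisation (X ^ n - C e) (X - C e) r s f
  root : ∀ i ∈ Finset.Icc 1 (r + s), aeval (α i) (f i) = 0

namespace RootedFactorisation

variable {F K : Type*} [Field F] [Field K] [Algebra F K]
  {n : ℕ} {e : F} {r s : ℕ} {f : ℕ → F[X]} {α : ℕ → K}

theorem unit_ne_zero (h : RootedFactorisation n e r s f α) : e ≠ 0 := by
  intro he
  have := h.sq_eq_one
  simp [he] at this

theorem squarefree (h : RootedFactorisation n e r s f α) : Squarefree (X ^ n - C e : F[X]) :=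
  (separable_X_pow_sub_C e h.natCast_ne_zero h.unit_ne_zero).squarefree

theorem coeff_zero_ne_zero (h : RootedFactorisation n e r s f α) :
    (X ^ n - C e : F[X]).coeff 0 ≠ 0 := by
  have hn : n ≠ 0 := h.odd.pos.ne'
  simp [coeff_X_pow, hn.symm, h.unit_ne_zero]

theorem mem_of_self (_ : RootedFactorisation n e r s f α) {i : ℕ} (hi : i ∈ Finset.Icc 2 r) :
    i ∈ Finset.Icc 1 (r + s) := by
  rw [Finset.mem_Icc] at hi ⊢
  omega

theorem mem_of_pair (_ : RootedFactorisation n e r s f α) {i : ℕ}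
    (hi : i ∈ Finset.Icc (r + 1) (r + s)) : i ∈ Finset.Icc 1 (r + s) := by
  rw [Finset.mem_Icc] at hi ⊢
  omega

theorem root_ne_zero (h : RootedFactorisation n e r s f α) {i : ℕ}
    (hi : i ∈ Finset.Icc 1 (r + s)) : α i ≠ 0 :=
  ne_zero_of_coeff_zero_ne_zero (h.fact.coeff_zero_ne_zero h.coeff_zero_ne_zero hi) (h.root i hi)

theorem root_pow (h : RootedFactorisation n e r s f α) {i : ℕ}
    (hi : i ∈ Finset.Icc 1 (r + s)) : α i ^ n = algebraMap F K e := by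
  obtain ⟨R, hR⟩ := h.fact.dvd hi
  have := congrArg (aeval (α i)) hR
  rwa [map_mul, h.root i hi, zero_mul, map_sub, map_pow, aeval_X, aeval_C, sub_eq_zero] at this

theorem eq_minpoly (h : RootedFactorisation n e r s f α) {i : ℕ}
    (hi : i ∈ Finset.Icc 1 (r + s)) : f i = minpoly F (α i) :=
  minpoly.eq_of_irreducible_of_monic (h.fact.irreducible i hi) (h.root i hi) (h.fact.monic i hi)

theorem isIntegral (h : RootedFactorisation n e r s f α) {i : ℕ}
    (hi : i ∈ Finset.Icc 1 (r + s)) : IsIntegral F (α i) :=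
  ⟨f i, h.fact.monic i hi, h.root i hi⟩

/-- As n is odd, α² = 1 would give α = α^n = e, making f_i a second copy of the factor X - e. -/
theorem root_sq_ne_one (h : RootedFactorisation n e r s f α) {i : ℕ}
    (hi : i ∈ Finset.Icc 2 r) : α i ^ 2 ≠ 1 := by
  intro h1
  have hα : α i = algebraMap F K e := by
    rw [← h.root_pow (h.mem_of_self hi)]
    obtain ⟨m, hm⟩ := h.odd
    rw [hm, pow_succ, pow_mul, h1, one_pow, one_mul]
  apply h.fact.ne_first h.squarefree hi
  rw [h.eq_minpoly (h.mem_of_self hi), hα, minpoly.eq_X_sub_C]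

theorem root_inv (h : RootedFactorisation n e r s f α) {i : ℕ}
    (hi : i ∈ Finset.Icc 2 r) : aeval (α i)⁻¹ (f i) = 0 := by
  have h1 : i ∈ Finset.Icc 1 r := by
    rw [Finset.mem_Icc] at hi ⊢
    omega
  have := aeval_inv_recip (h.root_ne_zero (h.mem_of_self hi)) (h.root i (h.mem_of_self hi))
  rwa [h.fact.selfReciprocal i h1] at this

theorem notMem (h : RootedFactorisation n e r s f α) {i : ℕ}
    (hi : i ∈ Finset.Icc 2 r) : α i ∉ F⟮α i + (α i)⁻¹⟯ :=
  have hi' := h.mem_of_self hi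
  notMem_adjoin_add_inv (h.fact.monic i hi') (h.fact.irreducible i hi') (h.root i hi')
    (h.root_inv hi) (h.root_ne_zero hi') (h.root_sq_ne_one hi)

theorem two_mul_finrank (h : RootedFactorisation n e r s f α) {i : ℕ}
    (hi : i ∈ Finset.Icc 2 r) :
    2 * Module.finrank F F⟮α i + (α i)⁻¹⟯ = (f i).natDegree :=
  have hi' := h.mem_of_self hi
  finrank_adjoin_add_inv (h.fact.monic i hi') (h.fact.irreducible i hi') (h.root i hi')
    (h.root_inv hi) (h.root_ne_zero hi') (h.root_sq_ne_one hi)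

theorem finrank_pair (h : RootedFactorisation n e r s f α) {i : ℕ}
    (hi : i ∈ Finset.Icc 1 (r + s)) : Module.finrank F F⟮α i⟯ = (f i).natDegree :=
  finrank_adjoin_simple_eq (h.fact.monic i hi) (h.fact.irreducible i hi) (h.root i hi)

theorem finiteDimensional_self (h : RootedFactorisation n e r s f α) {i : ℕ}
    (hi : i ∈ Finset.Icc 2 r) : FiniteDimensional F F⟮α i + (α i)⁻¹⟯ :=
  have := h.isIntegral (h.mem_of_self hi)
  IntermediateField.adjoin.finiteDimensional (this.add this.inv)

theorem finiteDimensional_pair (h : RootedFactorisation n e r s f α) {i : ℕ}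
    (hi : i ∈ Finset.Icc 1 (r + s)) : FiniteDimensional F F⟮α i⟯ :=
  IntermediateField.adjoin.finiteDimensional (h.isIntegral hi)

theorem dvd_of_roots (h : RootedFactorisation n e r s f α) {R : F[X]} (h0 : aeval e R = 0)
    (h1 : ∀ i ∈ Finset.Icc 2 r, aeval (α i) R = 0)
    (h2 : ∀ i ∈ Finset.Icc (r + 1) (r + s), aeval (α i) R = 0 ∧ aeval (α i)⁻¹ R = 0) :
    X ^ n - C e ∣ R := by
  refine h.fact.dvd_of_forall_dvd h.squarefree ?_ ?_
  · intro i hi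
    by_cases hi1 : i = 1
    · rw [hi1, h.fact.first, dvd_iff_isRoot]
      simpa using h0
    rw [h.eq_minpoly hi]
    apply minpoly.dvd
    rw [Finset.mem_Icc] at hi
    by_cases hir : i ≤ r
    · exact h1 i (Finset.mem_Icc.2 (by omega))
    · exact (h2 i (Finset.mem_Icc.2 (by omega))).1
  · intro i hi
    have hi' := h.mem_of_pair hi
    rw [← minpoly_inv_eq_recip (h.fact.monic i hi') (h.fact.irreducible i hi')
      (h.fact.coeff_zero_ne_zero h.coeff_zero_ne_zero hi') (h.root i hi')]
    exact minpoly.dvd F _ (h2 i hi).2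

theorem sum_natDegree (h : RootedFactorisation n e r s f α) :
    n = 1 + ∑ i ∈ Finset.Icc 2 r, (f i).natDegree +
      ∑ i ∈ Finset.Icc (r + 1) (r + s), 2 * (f i).natDegree := by
  have := h.fact.natDegree_eq h.coeff_zero_ne_zero
  rwa [natDegree_X_pow_sub_C, natDegree_X_sub_C] at this

end RootedFactorisation

/-! ### The matrix components -/

section Components

variable {F K : Type*} [Field F] [Field K] [Algebra F K]

theorem diag_eq_diagonal (x y : K) : (!![x, 0; 0, y] : M2 K) = Matrix.diagonal ![x, y] := by
  ext i j
  fin_cases i <;> fin_cases j <;> rfl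

theorem of_fin_two_congr {R : Type*} {a b c d a' b' c' d' : R} (ha : a = a') (hb : b = b')
    (hc : c = c') (hd : d = d') : (!![a, b; c, d] : M2 R) = !![a', b'; c', d'] := by
  rw [ha, hb, hc, hd]

theorem diag_pow (x y : K) (k : ℕ) :
    (!![x, 0; 0, y] : M2 K) ^ k = !![x ^ k, 0; 0, y ^ k] := by
  rw [diag_eq_diagonal, Matrix.diagonal_pow, diag_eq_diagonal]
  congr 1
  ext i
  fin_cases i <;> rfl

theorem aeval_diag (x y : K) (P : F[X]) :
    aeval (!![x, 0; 0, y] : M2 K) P = !![aeval x P, 0; 0, aeval y P] := by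
  induction P using Polynomial.induction_on' with
  | add p q hp hq =>
    rw [map_add, hp, hq, map_add, map_add]
    ext i j
    fin_cases i <;> fin_cases j <;> simp
  | monomial k c =>
    rw [aeval_monomial, aeval_monomial, aeval_monomial, diag_pow, ← Algebra.smul_def,
      ← Algebra.smul_def, ← Algebra.smul_def]
    ext i j
    fin_cases i <;> fin_cases j <;> simp

/-- Conjugation by an invertible matrix. -/
noncomputable def conjHom (F : Type*) [Field F] [Algebra F K] (Z : M2 K) (hZ : Z.det ≠ 0) :
    M2 K →ₐ[F] M2 K where
  toFun X := Z * X * Z⁻¹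
  map_one' := by rw [mul_one, Matrix.mul_nonsing_inv _ (isUnit_iff_ne_zero.2 hZ)]
  map_mul' X Y := by
    have h := Matrix.nonsing_inv_mul Z (isUnit_iff_ne_zero.2 hZ)
    calc Z * (X * Y) * Z⁻¹ = Z * X * 1 * Y * Z⁻¹ := by simp only [mul_one, mul_assoc]
      _ = Z * X * Z⁻¹ * (Z * Y * Z⁻¹) := by rw [← h]; simp only [mul_assoc]
  map_zero' := by rw [mul_zero, zero_mul]
  map_add' X Y := by rw [mul_add, add_mul]
  commutes' c := by
    rw [Algebra.algebraMap_eq_smul_one, mul_smul_comm, mul_one, smul_mul_assoc,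
      Matrix.mul_nonsing_inv _ (isUnit_iff_ne_zero.2 hZ)]

/-- The matrices `A`, `B` over `L` generate a copy of the standard representation of `Q_n`, with
`a` acting through the eigenvalues `α`, `α⁻¹` and `b` interchanging the eigenvectors, and they
preserve the bilinear form with Gram matrix `S`. -/
structure IsComponent (L : IntermediateField F K) (α ε₁ ε₂ : K) (S A B : M2 L) : Prop where
  exists_hom : ∃ f : M2 L →ₐ[F] M2 K, Function.Injective f ∧ f A = !![α, 0; 0, α⁻¹] ∧
    f B = !![0, ε₁; ε₂, 0]
  form_left : A * S * A.transpose = S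
  form_right : B * S * B.transpose = S

variable {L : IntermediateField F K}

/-- The inclusion of `M₂(L)` into `M₂(K)`. -/
noncomputable def toKHom (L : IntermediateField F K) : M2 L →ₐ[F] M2 K := L.val.mapMatrix

theorem toK_of (a b c d : L) :
    toK (!![a, b; c, d] : M2 L) = !![(a : K), (b : K); (c : K), (d : K)] := by
  ext i j
  fin_cases i <;> fin_cases j <;> rfl

/-- M₂(L) is a simple ring. -/
theorem injective_of_matrix (f : M2 L →ₐ[F] M2 K) : Function.Injective f :=
  f.toRingHom.injective

theorem exists_hom_of_conj {Z D E : M2 K} {A B : M2 L} (hZ : Z.det ≠ 0)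
    (hA : toK A = Z⁻¹ * D * Z) (hB : toK B = Z⁻¹ * E * Z) :
    ∃ f : M2 L →ₐ[F] M2 K, Function.Injective f ∧ f A = D ∧ f B = E := by
  have h := Matrix.mul_nonsing_inv Z (isUnit_iff_ne_zero.2 hZ)
  have key : ∀ X : M2 K, Z * (Z⁻¹ * X * Z) * Z⁻¹ = X := by
    intro X
    calc Z * (Z⁻¹ * X * Z) * Z⁻¹ = (Z * Z⁻¹) * X * (Z * Z⁻¹) := by simp only [mul_assoc]
      _ = X := by rw [h, one_mul, mul_one]
  refine ⟨(conjHom F Z hZ).comp (toKHom L), injective_of_matrix _, ?_, ?_⟩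
  · change Z * toK A * Z⁻¹ = D
    rw [hA, key]
  · change Z * toK B * Z⁻¹ = E
    rw [hB, key]

/-- Lets conjugacy be checked entrywise without computing Z⁻¹. -/
theorem eq_conj_of_mul_eq {Z D A : M2 K} (hZ : Z.det ≠ 0) (h : Z * A = D * Z) :
    A = Z⁻¹ * D * Z := by
  rw [mul_assoc, ← h, ← mul_assoc, Matrix.nonsing_inv_mul _ (isUnit_iff_ne_zero.2 hZ), one_mul]

theorem symplectic_of_det_eq_one {A : M2 L} (h : A.det = 1) :
    A * !![0, 1; -1, 0] * A.transpose = !![0, 1; -1, 0] := by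
  rw [mul_mul_transpose_symplectic, h, one_smul]

/-- a acts by the companion matrix of X² - wX + 1. The Gram matrix is that of twice the norm form
(x, y) ↦ (x + yα)(x + yα⁻¹). -/
theorem isComponent_sigma {α : K} (h0 : α ≠ 0) (h1 : α ^ 2 ≠ 1) {w : L}
    (hw : (w : K) = α + α⁻¹) :
    toK (!![0, 1; -1, w] : M2 L) = sigmaMap α !![α, 0; 0, α⁻¹] ∧
    toK (!![1, -w; 0, -1] : M2 L) = sigmaMap α !![0, 1; 1, 0] ∧
    IsComponent L α 1 1 !![2, w; w, 2] !![0, 1; -1, w] !![1, -w; 0, -1] := by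
  have hZ : (!![1, -α; 1, -α⁻¹] : M2 K).det ≠ 0 := by
    rw [Matrix.det_fin_two_of]
    intro h
    apply inv_ne_self h0 h1
    linear_combination h
  have hA : toK (!![0, 1; -1, w] : M2 L) = sigmaMap α !![α, 0; 0, α⁻¹] := by
    refine eq_conj_of_mul_eq hZ ?_
    rw [toK_of]
    ext i j
    fin_cases i <;> fin_cases j <;> simp [Matrix.mul_apply, Fin.sum_univ_two, hw] <;>
      field_simp <;> ring
  have hB : toK (!![1, -w; 0, -1] : M2 L) = sigmaMap α !![0, 1; 1, 0] := by
    refine eq_conj_of_mul_eq hZ ?_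
    rw [toK_of]
    ext i j
    fin_cases i <;> fin_cases j <;> simp [Matrix.mul_apply, Fin.sum_univ_two, hw]
  refine ⟨hA, hB, exists_hom_of_conj hZ hA hB, ?_, ?_⟩ <;>
  · rw [transpose_of_fin_two, Matrix.mul_fin_two, Matrix.mul_fin_two]
    refine of_fin_two_congr ?_ ?_ ?_ ?_ <;> ring

/-- Both matrices have determinant 1, so they preserve the alternating form. Here `i` is √-1 seen in
`L`. -/
theorem isComponent_gamma {β ι : K} (hι : ι ^ 2 = -1) (h0 : β ≠ 0) (h1 : β ^ 2 ≠ 1) {w i : L}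
    (hw : (w : K) = β + β⁻¹) (hi : (i : K) = ι) :
    toK (!![0, -i; -i, w] : M2 L) = gammaMap ι β !![β, 0; 0, β⁻¹] ∧
    toK (!![i, -w; 0, -i] : M2 L) = gammaMap ι β !![0, ι; ι, 0] ∧
    IsComponent L β ι ι !![0, 1; -1, 0] !![0, -i; -i, w] !![i, -w; 0, -i] := by
  have hι0 : ι ≠ 0 := by
    rintro rfl
    norm_num at hι
  have hii : i * i = -1 := by
    apply Subtype.val_injective
    simpa [hi, sq] using hι
  have hZ : (!![ι, -β; ι, -β⁻¹] : M2 K).det ≠ 0 := by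
    rw [Matrix.det_fin_two_of]
    intro h
    apply mul_ne_zero hι0 (inv_ne_self h0 h1)
    linear_combination h
  have hA : toK (!![0, -i; -i, w] : M2 L) = gammaMap ι β !![β, 0; 0, β⁻¹] := by
    refine eq_conj_of_mul_eq hZ ?_
    rw [toK_of, Matrix.mul_fin_two, Matrix.mul_fin_two]
    simp only [IntermediateField.coe_zero, IntermediateField.coe_neg, hw, hi]
    refine of_fin_two_congr ?_ ?_ ?_ ?_ <;> field_simp
    · ring
    · linear_combination -β * hι
    · linear_combination -β ^ 2 * hι
  have hB : toK (!![i, -w; 0, -i] : M2 L) = gammaMap ι β !![0, ι; ι, 0] := by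
    refine eq_conj_of_mul_eq hZ ?_
    rw [toK_of, Matrix.mul_fin_two, Matrix.mul_fin_two]
    simp only [IntermediateField.coe_zero, IntermediateField.coe_neg, hw, hi]
    refine of_fin_two_congr ?_ ?_ ?_ ?_ <;> ring
  refine ⟨hA, hB, exists_hom_of_conj hZ hA hB, symplectic_of_det_eq_one ?_,
    symplectic_of_det_eq_one ?_⟩ <;>
  · rw [Matrix.det_fin_two_of]
    linear_combination -hii

/-- θ is an inner automorphism over `K`. The determinant of the conjugating matrix is v² + (ι - u)²
= 2ι(ι - u), nonzero exactly because u ≠ ι. -/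
theorem thetaMap_eq_conj (h2 : (2 : K) ≠ 0) {ι u v : K} (hι : ι ^ 2 = -1)
    (huv : u ^ 2 + v ^ 2 = -1) (hu : u ≠ ι) (X : M2 K) :
    (!![v, ι - u; -(ι - u), v] : M2 K).det ≠ 0 ∧
    thetaMap ι u v X =
      (!![v, ι - u; -(ι - u), v] : M2 K)⁻¹ * X * !![v, ι - u; -(ι - u), v] := by
  have hι0 : ι ≠ 0 := by
    rintro rfl
    norm_num at hι
  have hZ : (!![v, ι - u; -(ι - u), v] : M2 K).det ≠ 0 := by
    rw [Matrix.det_fin_two_of]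
    intro h
    have : 2 * ι * (ι - u) = 0 := by linear_combination h - huv + hι
    exact mul_ne_zero (mul_ne_zero h2 hι0) (sub_ne_zero.2 hu.symm) this
  refine ⟨hZ, eq_conj_of_mul_eq hZ ?_⟩
  rw [Matrix.eta_fin_two X]
  generalize X 0 0 = a
  generalize X 0 1 = b
  generalize X 1 0 = c
  generalize X 1 1 = d
  obtain ⟨x₁, x₂, hx₁, hx₂⟩ : ∃ x₁ x₂, a = x₁ + x₂ * ι ∧ d = x₁ - x₂ * ι :=
    ⟨(a + d) / 2, (a - d) / (2 * ι), by field_simp; ring, by field_simp; ring⟩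
  obtain ⟨x₃, x₄, hx₃, hx₄⟩ : ∃ x₃ x₄, b = x₃ + x₄ * ι ∧ c = -(x₃ - x₄ * ι) :=
    ⟨(b - c) / 2, (b + c) / (2 * ι), by field_simp; ring, by field_simp; ring⟩
  rw [hx₁, hx₂, hx₃, hx₄, thetaMap_apply h2 hι, Matrix.mul_fin_two, Matrix.mul_fin_two]
  have h3 : u ^ 2 + v ^ 2 - ι ^ 2 = 0 := by rw [huv, hι, sub_self]
  refine of_fin_two_congr ?_ ?_ ?_ ?_
  · linear_combination x₄ * (-h3)
  · linear_combination x₂ * h3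
  · linear_combination x₂ * h3
  · linear_combination x₄ * h3

/-- Here `i` is (β - β⁻¹)/√-1, so w² + i² = 4 and the image of a has determinant 1. The coordinates
x₁, …, x₄ are w/2, i/2, 0, 0 for a and 0, 0, 0, 1 for b. -/
theorem isComponent_theta (h2 : (2 : K) ≠ 0) {β ι u v : K} (hι : ι ^ 2 = -1) (h0 : β ≠ 0)
    {w i U V : L} (hw : (w : K) = β + β⁻¹) (hi : (i : K) = (β - β⁻¹) / ι) (hU : (U : K) = u)
    (hV : (V : K) = v) (huv : u ^ 2 + v ^ 2 = -1) (hu : u ≠ ι) :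
    toK (!![w / 2 + i / 2 * U, i / 2 * V; i / 2 * V, w / 2 - i / 2 * U] : M2 L) =
      thetaMap ι u v !![β, 0; 0, β⁻¹] ∧
    toK (!![-V, U; U, V] : M2 L) = thetaMap ι u v !![0, ι; ι, 0] ∧
    IsComponent L β ι ι !![0, 1; -1, 0]
      !![w / 2 + i / 2 * U, i / 2 * V; i / 2 * V, w / 2 - i / 2 * U] !![-V, U; U, V] := by
  have hι0 : ι ≠ 0 := by
    rintro rfl
    norm_num at hι
  have h22 : ((2 : L) : K) = 2 := rfl
  have h2' : (2 : L) ≠ 0 := fun h => h2 (congrArg (fun z : L => (z : K)) h)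
  have hUV : U ^ 2 + V ^ 2 = -1 := by
    apply Subtype.val_injective
    simpa [hU, hV] using huv
  have hwi : w ^ 2 + i ^ 2 = 4 := by
    apply Subtype.val_injective
    change (w : K) ^ 2 + (i : K) ^ 2 = 4
    rw [hw, hi, div_pow, hι]
    field_simp
    ring
  have hA : toK (!![w / 2 + i / 2 * U, i / 2 * V; i / 2 * V, w / 2 - i / 2 * U] : M2 L) =
      thetaMap ι u v !![β, 0; 0, β⁻¹] := by
    have e : (!![β, 0; 0, β⁻¹] : M2 K) = !![(w : K) / 2 + (i : K) / 2 * ι, 0 + 0 * ι;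
        -(0 - 0 * ι), (w : K) / 2 - (i : K) / 2 * ι] := by
      rw [hw, hi]
      refine of_fin_two_congr ?_ ?_ ?_ ?_
      · field_simp; ring
      · ring
      · ring
      · field_simp; ring
    rw [e, thetaMap_apply h2 hι, toK_of, ← hU, ← hV]
    refine of_fin_two_congr ?_ ?_ ?_ ?_ <;> push_cast [h22] <;> ring
  have hB : toK (!![-V, U; U, V] : M2 L) = thetaMap ι u v !![0, ι; ι, 0] := by
    have e : (!![0, ι; ι, 0] : M2 K) = !![0 + 0 * ι, 0 + 1 * ι; -(0 - 1 * ι), 0 - 0 * ι] := by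
      refine of_fin_two_congr ?_ ?_ ?_ ?_ <;> ring
    rw [e, thetaMap_apply h2 hι, toK_of, ← hU, ← hV]
    refine of_fin_two_congr ?_ ?_ ?_ ?_ <;> push_cast [h22] <;> ring
  obtain ⟨hZ, hAZ⟩ := thetaMap_eq_conj h2 hι huv hu !![β, 0; 0, β⁻¹]
  obtain ⟨-, hBZ⟩ := thetaMap_eq_conj h2 hι huv hu !![0, ι; ι, 0]
  refine ⟨hA, hB, exists_hom_of_conj hZ (hA.trans hAZ) (hB.trans hBZ),
    symplectic_of_det_eq_one ?_, symplectic_of_det_eq_one ?_⟩ <;>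
  rw [Matrix.det_fin_two_of]
  · field_simp
    linear_combination hwi - i ^ 2 * hUV
  · linear_combination -hUV

/-- Serves both kinds of reciprocal pair: ε = 1 with the hyperbolic form and ε = -1 with the
alternating one. -/
theorem isComponent_pair {α : K} {ε : F} {x : L} (hx : (x : K) = α) {S : M2 L}
    (hA : !![x, 0; 0, x⁻¹] * S * !![x, 0; 0, x⁻¹] = S)
    (hB : !![0, algebraMap F L ε; 1, 0] * S * !![0, 1; algebraMap F L ε, 0] = S) :
    toK (!![x, 0; 0, x⁻¹] : M2 L) = !![α, 0; 0, α⁻¹] ∧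
    toK (!![0, algebraMap F L ε; 1, 0] : M2 L) = !![0, algebraMap F K ε; 1, 0] ∧
    IsComponent L α (algebraMap F K ε) 1 S !![x, 0; 0, x⁻¹] !![0, algebraMap F L ε; 1, 0] := by
  have h1 : toK (!![x, 0; 0, x⁻¹] : M2 L) = !![α, 0; 0, α⁻¹] := by
    rw [toK_of, IntermediateField.coe_inv, hx]
    rfl
  have h2 : toK (!![0, algebraMap F L ε; 1, 0] : M2 L) = !![0, algebraMap F K ε; 1, 0] := by
    rw [toK_of]
    rfl
  refine ⟨h1, h2, ⟨toKHom L, injective_of_matrix _, h1, h2⟩, ?_, ?_⟩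
  · rwa [transpose_of_fin_two]
  · rwa [transpose_of_fin_two]

namespace IsComponent

variable {α ε₁ ε₂ : K} {S A B : M2 L}

theorem quatRelations (h : IsComponent L α ε₁ ε₂ S A B) {n : ℕ} {e : K} (h0 : α ≠ 0)
    (he : e ^ 2 = 1) (hα : α ^ n = e) (hε : ε₁ * ε₂ = e) : QuatRelations n A B := by
  obtain ⟨f, hf, hA, hB⟩ := h.exists_hom
  have he' : e⁻¹ = e := inv_eq_of_mul_eq_one_right (by rw [← sq, he])
  refine QuatRelations.of_injective (f : M2 L →* M2 K) hf ?_
  simp only [MonoidHom.coe_coe, hA, hB]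
  refine ⟨?_, ?_, ?_⟩
  · rw [diag_pow, inv_pow, mul_comm 2 n, pow_mul, hα, he, inv_one, ← Matrix.one_fin_two]
  · rw [diag_pow, inv_pow, hα, he', Matrix.mul_fin_two, mul_comm ε₂, hε]
    simp [mul_comm ε₂, hε]
  · rw [Matrix.mul_fin_two, Matrix.mul_fin_two]
    simp only [mul_zero, zero_mul, add_zero, zero_add]
    refine of_fin_two_congr rfl ?_ ?_ rfl <;> field_simp

/-- Over `K` the element becomes [P(α), ε₁Q(α⁻¹); ε₂Q(α), P(α⁻¹)], whose four entries vanish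
separately. -/
theorem aeval_eq_zero (h : IsComponent L α ε₁ ε₂ S A B) (h₁ : ε₁ ≠ 0) (h₂ : ε₂ ≠ 0) {P Q : F[X]}
    (hPQ : aeval A P + B * aeval A Q = 0) :
    (aeval α P = 0 ∧ aeval α⁻¹ P = 0) ∧ (aeval α Q = 0 ∧ aeval α⁻¹ Q = 0) := by
  obtain ⟨f, hf, hA, hB⟩ := h.exists_hom
  have := congrArg f hPQ
  rw [map_add, map_mul, ← aeval_algHom_apply, ← aeval_algHom_apply, hA, hB, aeval_diag,
    aeval_diag, Matrix.mul_fin_two, map_zero, ← Matrix.ext_iff] at this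
  simp [h₁, h₂] at this
  tauto

theorem form_of {n : ℕ} [NeZero n] (h : IsComponent L α ε₁ ε₂ S A B)
    (φ : MonoidAlgebra F (QuaternionGroup n) →ₐ[F] M2 L)
    (hA : φ (.of F _ (QuaternionGroup.a 1)) = A) (hB : φ (.of F _ (QuaternionGroup.xa 0)) = B)
    (g : QuaternionGroup n) : φ (.of F _ g) * S * (φ (.of F _ g)).transpose = S := by
  induction g using quaternionGroup_induction with
  | one => rw [map_one, map_one, Matrix.transpose_one, one_mul, mul_one]
  | mul g k hg hk =>
    rw [map_mul, map_mul, Matrix.transpose_mul]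
    conv_rhs => rw [← hg, ← hk]
    simp only [mul_assoc]
  | ha => rw [hA, h.form_left]
  | hb => rw [hB, h.form_right]

end IsComponent
end Components

/-! ### The isomorphism `ψ` -/

section Images

variable {F K : Type*} [Field F] [Field K] [Algebra F K] {n r s : ℕ} {f : ℕ → F[X]} {α : ℕ → K}

/-- The Gram matrix of the form preserved by `ρ_i` for `2 ≤ i ≤ r`. -/
noncomputable def normForm (F : Type*) [Field F] [Algebra F K] (α : K) : M2 F⟮α + α⁻¹⟯ :=
  !![2, IntermediateField.AdjoinSimple.gen F (α + α⁻¹);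
    IntermediateField.AdjoinSimple.gen F (α + α⁻¹), 2]

theorem exists_rho_self {e : F} (h : RootedFactorisation n e r s f α) {i : ℕ}
    (hi : i ∈ Finset.Icc 2 r) :
    ∃ A B : M2 F⟮α i + (α i)⁻¹⟯, toK A = sigmaMap (α i) !![α i, 0; 0, (α i)⁻¹] ∧
      toK B = sigmaMap (α i) !![0, 1; 1, 0] ∧
      IsComponent _ (α i) 1 1 (normForm F (α i)) A B :=
  ⟨_, _, isComponent_sigma (h.root_ne_zero (h.mem_of_self hi)) (h.root_sq_ne_one hi)
    (IntermediateField.AdjoinSimple.coe_gen F _)⟩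

theorem exists_rho_pair {α : K} (h0 : α ≠ 0) :
    ∃ A B : M2 F⟮α⟯, toK A = !![α, 0; 0, α⁻¹] ∧ toK B = !![0, 1; 1, 0] ∧
      IsComponent _ α 1 1 !![0, 1; 1, 0] A B := by
  have hx := IntermediateField.AdjoinSimple.coe_gen F α
  have hx0 : IntermediateField.AdjoinSimple.gen F α ≠ 0 := fun h => h0 (by rw [← hx, h]; rfl)
  have := isComponent_pair (ε := (1 : F)) hx (S := !![0, 1; 1, 0])
    (by rw [Matrix.mul_fin_two, Matrix.mul_fin_two]; simp [hx0])
    (by rw [Matrix.mul_fin_two, Matrix.mul_fin_two]; simp)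
  rw [map_one, map_one] at this
  exact ⟨_, _, this⟩

theorem exists_eta_pair {β : K} (h0 : β ≠ 0) :
    ∃ A B : M2 F⟮β⟯, toK A = !![β, 0; 0, β⁻¹] ∧ toK B = !![0, -1; 1, 0] ∧
      IsComponent _ β (-1) 1 !![0, 1; -1, 0] A B := by
  have hx := IntermediateField.AdjoinSimple.coe_gen F β
  have hx0 : IntermediateField.AdjoinSimple.gen F β ≠ 0 := fun h => h0 (by rw [← hx, h]; rfl)
  have := isComponent_pair (ε := (-1 : F)) hx (S := !![0, 1; -1, 0])
    (by rw [Matrix.mul_fin_two, Matrix.mul_fin_two]; simp [hx0])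
    (by rw [Matrix.mul_fin_two, Matrix.mul_fin_two]; simp)
  rw [map_neg, map_neg, map_one, map_one] at this
  exact ⟨_, _, this⟩

theorem exists_eta_self [Fintype F] {e : F} (hq : Fintype.card F % 4 = 3) (h2 : (2 : K) ≠ 0)
    {ι : K} (hι : ι ^ 2 = -1)
    (h : RootedFactorisation n e r s f α) {j : ℕ} (hj : j ∈ Finset.Icc 2 r) {u v : K}
    (huv : ¬ 4 ∣ (f j).natDegree →
      u ∈ F⟮α j + (α j)⁻¹⟯ ∧ v ∈ F⟮α j + (α j)⁻¹⟯ ∧ u ^ 2 + v ^ 2 = -1) :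
    ∃ A B : M2 F⟮α j + (α j)⁻¹⟯,
      ((4 ∣ (f j).natDegree → toK A = gammaMap ι (α j) !![α j, 0; 0, (α j)⁻¹]) ∧
        (¬ 4 ∣ (f j).natDegree → toK A = thetaMap ι u v !![α j, 0; 0, (α j)⁻¹])) ∧
      ((4 ∣ (f j).natDegree → toK B = gammaMap ι (α j) !![0, ι; ι, 0]) ∧
        (¬ 4 ∣ (f j).natDegree → toK B = thetaMap ι u v !![0, ι; ι, 0])) ∧
      IsComponent _ (α j) ι ι !![0, 1; -1, 0] A B := by
  have h0 := h.root_ne_zero (h.mem_of_self hj)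
  have hw := IntermediateField.AdjoinSimple.coe_gen F (α j + (α j)⁻¹)
  have hdeg := h.two_mul_finrank hj
  have := h.finiteDimensional_self hj
  -- The field F(α + α⁻¹) has degree deg f_j / 2, so this is a split on the parity of that degree.
  by_cases h4 : 4 ∣ (f j).natDegree
  · have hi := mem_adjoin_of_even_finrank hq hι F⟮α j + (α j)⁻¹⟯
      ((Nat.even_iff).2 (by omega))
    obtain ⟨hA, hB, hC⟩ := isComponent_gamma hι h0 (h.root_sq_ne_one hj) hw (i := ⟨ι, hi⟩) rfl
    exact ⟨_, _, ⟨fun _ => hA, fun h => absurd h4 h⟩, ⟨fun _ => hB, fun h => absurd h4 h⟩, hC⟩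
  · have hodd : ¬ Even (Module.finrank F F⟮α j + (α j)⁻¹⟯) := by
      rw [Nat.even_iff]
      omega
    have hi := sub_inv_div_mem_of_odd_finrank hq hι F⟮α j + (α j)⁻¹⟯ hodd h0 (h.notMem hj)
      (IntermediateField.mem_adjoin_simple_self F _)
    obtain ⟨hu, hv, huv⟩ := huv h4
    -- Otherwise √-1 lies in the subfield, hence so does α - α⁻¹, and adding α + α⁻¹ puts 2α there.
    have huι : u ≠ ι := by
      rintro rfl
      have hmul := mul_mem hi hu
      have hι0 : u ≠ 0 := by
        rintro rfl
        norm_num at hι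
      rw [div_mul_cancel₀ _ hι0] at hmul
      have hsum := add_mem hmul (IntermediateField.mem_adjoin_simple_self F (α j + (α j)⁻¹))
      have h2F : (2 : K) ∈ F⟮α j + (α j)⁻¹⟯ := ofNat_mem _ 2
      have := mul_mem (inv_mem h2F) hsum
      apply h.notMem hj
      convert this using 1
      field_simp
      ring
    obtain ⟨hA, hB, hC⟩ := isComponent_theta h2 hι h0 hw (i := ⟨_, hi⟩) (U := ⟨u, hu⟩)
      (V := ⟨v, hv⟩) rfl rfl rfl huv huι
    exact ⟨_, _, ⟨fun h => absurd h h4, fun _ => hA⟩, ⟨fun h => absurd h h4, fun _ => hB⟩, hC⟩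

end Images

/-! ### Existence and bijectivity of ψ. -/

section Psi

variable {F K : Type*} [Field F] [Field K] [Algebra F K]

/-- Each component of `(y, z)`, where `y` and `z` are the images of `a` and `b`, is of the
expected shape. -/
structure AreComponents {r s t k : ℕ} {α β : ℕ → K} {ι : K}
    (y z : AlgA F r s α × AlgB F t k β ι) : Prop where
  rho_one_a : y.1.1 = (1, 1)
  rho_one_b : z.1.1 = (1, -1)
  rho_self : ∀ i : Finset.Icc 2 r,
    IsComponent _ (α i) 1 1 (normForm F (α i)) (y.1.2.1 i) (z.1.2.1 i)
  rho_pair : ∀ i : Finset.Icc (r + 1) (r + s),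
    IsComponent _ (α i) 1 1 !![0, 1; 1, 0] (y.1.2.2 i) (z.1.2.2 i)
  eta_one_a : y.2.1 = -1
  eta_one_b : (z.2.1 : K) = ι
  eta_self : ∀ j : Finset.Icc 2 t,
    IsComponent _ (β j) ι ι !![0, 1; -1, 0] (y.2.2.1 j) (z.2.2.1 j)
  eta_pair : ∀ j : Finset.Icc (t + 1) (t + k),
    IsComponent _ (β j) (-1) 1 !![0, 1; -1, 0] (y.2.2.2 j) (z.2.2.2 j)

variable {n r s t k : ℕ} {f g : ℕ → F[X]} {α β : ℕ → K} {ι : K}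
  {y z : AlgA F r s α × AlgB F t k β ι}

theorem AreComponents.quatRelations (h : AreComponents y z) (hι : ι ^ 2 = -1)
    (hf : RootedFactorisation n 1 r s f α) (hg : RootedFactorisation n (-1) t k g β) :
    QuatRelations n y z := by
  refine .prod (.prod ?_ (.prod (.pi fun i => ?_) (.pi fun i => ?_)))
    (.prod ?_ (.prod (.pi fun j => ?_) (.pi fun j => ?_)))
  · rw [h.rho_one_a, h.rho_one_b]
    constructor <;> simp
  · exact (h.rho_self i).quatRelations (hf.root_ne_zero (hf.mem_of_self i.2)) (e := 1)
      (by norm_num) (by simpa using hf.root_pow (hf.mem_of_self i.2)) (by norm_num)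
  · exact (h.rho_pair i).quatRelations (hf.root_ne_zero (hf.mem_of_pair i.2)) (e := 1)
      (by norm_num) (by simpa using hf.root_pow (hf.mem_of_pair i.2)) (by norm_num)
  · rw [h.eta_one_a]
    have hz : z.2.1 * z.2.1 = -1 := by
      apply Subtype.val_injective
      simpa [h.eta_one_b, sq] using hι
    refine ⟨by rw [pow_mul, neg_one_sq, one_pow], by rw [hz, hf.odd.neg_one_pow], by ring⟩
  · exact (h.eta_self j).quatRelations (hg.root_ne_zero (hg.mem_of_self j.2)) (e := -1)
      (by norm_num) (by simpa using hg.root_pow (hg.mem_of_self j.2)) (by rw [← sq, hι])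
  · exact (h.eta_pair j).quatRelations (hg.root_ne_zero (hg.mem_of_pair j.2)) (e := -1)
      (by norm_num) (by simpa using hg.root_pow (hg.mem_of_pair j.2)) (by norm_num)

theorem aeval_prod_fst {R S : Type*} [Ring R] [Ring S] [Algebra F R] [Algebra F S] (x : R × S)
    (P : F[X]) : (aeval x P).1 = aeval x.1 P :=
  (aeval_algHom_apply (AlgHom.fst F R S) x P).symm

theorem aeval_prod_snd {R S : Type*} [Ring R] [Ring S] [Algebra F R] [Algebra F S] (x : R × S)
    (P : F[X]) : (aeval x P).2 = aeval x.2 P :=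
  (aeval_algHom_apply (AlgHom.snd F R S) x P).symm

theorem aeval_pi {I : Type*} {R : I → Type*} [∀ i, Ring (R i)] [∀ i, Algebra F (R i)]
    (x : ∀ i, R i) (P : F[X]) (i : I) : aeval x P i = aeval (x i) P :=
  (aeval_algHom_apply (Pi.evalAlgHom F R i) x P).symm

/-- The components together make P and Q vanish at all roots of X^n - 1 and X^n + 1. At 1 one gets
P(1) ± Q(1) = 0, at -1 one gets P(-1) + √-1 Q(-1) = 0. -/
theorem AreComponents.dvd_of_eq_zero [Fintype F] (h : AreComponents y z)
    (hq : Fintype.card F % 4 = 3) (h2 : (2 : K) ≠ 0) (hι : ι ^ 2 = -1)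
    (hf : RootedFactorisation n 1 r s f α) (hg : RootedFactorisation n (-1) t k g β)
    {P Q : F[X]} (hPQ : aeval y P + z * aeval y Q = 0) :
    X ^ (2 * n) - 1 ∣ P ∧ X ^ (2 * n) - 1 ∣ Q := by
  have hι0 : ι ≠ 0 := by
    rintro rfl
    norm_num at hι
  have h2F : (2 : F) ≠ 0 := by
    intro h
    apply h2
    have := congrArg (algebraMap F K) h
    rwa [map_ofNat, map_zero] at this
  have hA1 := congrArg (fun x => x.1.1.1) hPQ
  have hA1' := congrArg (fun x => x.1.1.2) hPQ
  have hA2 := fun i => congrArg (fun x => x.1.2.1 i) hPQ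
  have hA3 := fun i => congrArg (fun x => x.1.2.2 i) hPQ
  have hB1 := congrArg (fun x => x.2.1) hPQ
  have hB2 := fun i => congrArg (fun x => x.2.2.1 i) hPQ
  have hB3 := fun i => congrArg (fun x => x.2.2.2 i) hPQ
  simp only [Prod.fst_add, Prod.snd_add, Prod.fst_mul, Prod.snd_mul, Prod.fst_zero, Prod.snd_zero,
    Pi.add_apply, Pi.mul_apply, Pi.zero_apply, aeval_prod_fst, aeval_prod_snd, aeval_pi]
    at hA1 hA1' hA2 hA3 hB1 hB2 hB3
  simp only [h.rho_one_a, h.rho_one_b] at hA1 hA1'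
  have hA2' := fun i => (h.rho_self i).aeval_eq_zero one_ne_zero one_ne_zero (hA2 i)
  have hA3' := fun i => (h.rho_pair i).aeval_eq_zero one_ne_zero one_ne_zero (hA3 i)
  have hB2' := fun j => (h.eta_self j).aeval_eq_zero hι0 hι0 (hB2 j)
  have hB3' := fun j => (h.eta_pair j).aeval_eq_zero (neg_ne_zero.2 one_ne_zero) one_ne_zero (hB3 j)
  have hP1 : aeval (1 : F) P = 0 :=
    (mul_eq_zero.1 (by linear_combination hA1 + hA1')).resolve_left h2F
  have hQ1 : aeval (1 : F) Q = 0 :=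
    (mul_eq_zero.1 (by linear_combination hA1 - hA1')).resolve_left h2F
  have hneg : ∀ R : F[X], ((aeval y.2.1 R : F⟮ι⟯) : K) = algebraMap F K (aeval (-1 : F) R) := by
    intro R
    rw [h.eta_one_a, ← aeval_algebraMap_apply, map_neg, map_one]
    exact (aeval_algHom_apply F⟮ι⟯.val (-1) R).symm.trans (by rw [map_neg, map_one])
  have hB1' := congrArg (fun x : F⟮ι⟯ => (x : K)) hB1
  simp only [IntermediateField.coe_add, IntermediateField.coe_mul, h.eta_one_b, hneg,
    IntermediateField.coe_zero] at hB1'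
  -- Both values lie in F while √-1 does not.
  have hQ2 : aeval (-1 : F) Q = 0 := by
    by_contra hne
    refine notMem_range_algebraMap hq hι h2 (-(aeval (-1 : F) P / aeval (-1 : F) Q)) ?_
    have hne' : algebraMap F K (aeval (-1 : F) Q) ≠ 0 := by
      rwa [ne_eq, map_eq_zero]
    rw [map_neg, map_div₀]
    field_simp
    linear_combination -hB1'
  have hP2 : aeval (-1 : F) P = 0 := by
    rw [hQ2, map_zero, mul_zero, add_zero, map_eq_zero] at hB1'
    exact hB1'
  have key : ∀ R : F[X], X ^ n - C 1 ∣ R → X ^ n - C (-1) ∣ R → X ^ (2 * n) - 1 ∣ R := by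
    intro R h1 h2
    have e : (X ^ (2 * n) - 1 : F[X]) = (X ^ n - C 1) * (X ^ n - C (-1)) := by
      rw [C_neg, C_1]
      ring
    rw [e]
    -- Bézout relation: the two factors differ by the unit 2.
    refine IsCoprime.mul_dvd ⟨-C (2 : F)⁻¹, C (2 : F)⁻¹, ?_⟩ h1 h2
    have : C (2 : F)⁻¹ * C 2 = 1 := by rw [← C_mul, inv_mul_cancel₀ h2F, C_1]
    have h22 : (C 2 : F[X]) = 2 := rfl
    rw [C_neg, C_1]
    rw [h22] at this
    linear_combination this
  constructor
  · apply key
    · exact hf.dvd_of_roots hP1 (fun i hi => (hA2' ⟨i, hi⟩).1.1) fun i hi => (hA3' ⟨i, hi⟩).1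
    · exact hg.dvd_of_roots hP2 (fun j hj => (hB2' ⟨j, hj⟩).1.1) fun j hj => (hB3' ⟨j, hj⟩).1
  · apply key
    · exact hf.dvd_of_roots hQ1 (fun i hi => (hA2' ⟨i, hi⟩).2.1) fun i hi => (hA3' ⟨i, hi⟩).2
    · exact hg.dvd_of_roots hQ2 (fun j hj => (hB2' ⟨j, hj⟩).2.1) fun j hj => (hB3' ⟨j, hj⟩).2

theorem finrank_monoidAlgebra [NeZero n] :
    Module.finrank F (MonoidAlgebra F (QuaternionGroup n)) = 4 * n := by
  rw [(MonoidAlgebra.coeffLinearEquiv F).finrank_eq, Module.finrank_finsupp_self,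
    QuaternionGroup.card]

theorem finrank_pi_matrix {I : Type*} [Fintype I] (L : I → IntermediateField F K)
    (h : ∀ i, FiniteDimensional F (L i)) : FiniteDimensional F (∀ i, M2 (L i)) ∧
      Module.finrank F (∀ i, M2 (L i)) = ∑ i, 2 * (2 * Module.finrank F (L i)) := by
  refine ⟨inferInstance, ?_⟩
  rw [Module.finrank_pi_fintype]
  simp only [Module.finrank_matrix, Fintype.card_fin, mul_assoc]

theorem finrank_prod_eq {V W : Type*} [AddCommGroup V] [Module F V] [AddCommGroup W] [Module F W]
    {a b : ℕ} (hV : FiniteDimensional F V ∧ Module.finrank F V = a)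
    (hW : FiniteDimensional F W ∧ Module.finrank F W = b) :
    FiniteDimensional F (V × W) ∧ Module.finrank F (V × W) = a + b := by
  obtain ⟨h, rfl⟩ := hV
  obtain ⟨h', rfl⟩ := hW
  exact ⟨inferInstance, Module.finrank_prod⟩

/-- The summand 2 is the dimension of the remaining component, F ⊕ F or F(√-1). A self-reciprocal
factor contributes 4 · deg/2 and a pair 4 · deg, twice their share of n. -/
theorem finrank_matrix_components {e : F} (hf : RootedFactorisation n e r s f α) :
    ∃ d, 2 + d = 2 * n ∧ FiniteDimensional F (((i : Finset.Icc 2 r) → M2 F⟮α i + (α i)⁻¹⟯) ×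
      ((i : Finset.Icc (r + 1) (r + s)) → M2 F⟮α i⟯)) ∧
      Module.finrank F (((i : Finset.Icc 2 r) → M2 F⟮α i + (α i)⁻¹⟯) ×
        ((i : Finset.Icc (r + 1) (r + s)) → M2 F⟮α i⟯)) = d := by
  refine ⟨_, ?_, finrank_prod_eq
    (finrank_pi_matrix _ fun i : Finset.Icc 2 r => hf.finiteDimensional_self i.2)
    (finrank_pi_matrix _ fun i : Finset.Icc (r + 1) (r + s) =>
      hf.finiteDimensional_pair (hf.mem_of_pair i.2))⟩
  have e1 : ∀ i : Finset.Icc 2 r,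
      2 * (2 * Module.finrank F F⟮α i + (α i)⁻¹⟯) = 2 * (f i).natDegree :=
    fun i => by rw [hf.two_mul_finrank i.2]
  have e2 : ∀ i : Finset.Icc (r + 1) (r + s),
      2 * (2 * Module.finrank F F⟮α i⟯) = 2 * (2 * (f i).natDegree) :=
    fun i => by rw [hf.finrank_pair (hf.mem_of_pair i.2)]
  simp only [e1, e2]
  rw [Finset.sum_coe_sort (Finset.Icc 2 r) (fun i => 2 * (f i).natDegree),
    Finset.sum_coe_sort (Finset.Icc (r + 1) (r + s)) (fun i => 2 * (2 * (f i).natDegree)),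
    ← Finset.mul_sum, ← Finset.mul_sum]
  have := hf.sum_natDegree
  omega

theorem finrank_algA {e : F} (hf : RootedFactorisation n e r s f α) :
    FiniteDimensional F (AlgA F r s α) ∧ Module.finrank F (AlgA F r s α) = 2 * n := by
  obtain ⟨d, hd, h⟩ := finrank_matrix_components hf
  have h1 : FiniteDimensional F F ∧ Module.finrank F F = 1 := ⟨inferInstance, Module.finrank_self F⟩
  rw [← hd]
  exact finrank_prod_eq (finrank_prod_eq h1 h1) h

theorem finrank_algB [Fintype F] {e : F} (hq : Fintype.card F % 4 = 3) (h2 : (2 : K) ≠ 0)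
    (hι : ι ^ 2 = -1) (hg : RootedFactorisation n e t k g β) :
    FiniteDimensional F (AlgB F t k β ι) ∧ Module.finrank F (AlgB F t k β ι) = 2 * n := by
  obtain ⟨d, hd, h⟩ := finrank_matrix_components hg
  have hfr := finrank_adjoin_sqrt_neg_one hq hι h2
  rw [← hd]
  exact finrank_prod_eq ⟨FiniteDimensional.of_finrank_pos (by omega), hfr⟩ h

theorem AreComponents.exists_algEquiv [NeZero n] [Fintype F] (h : AreComponents y z)
    (hq : Fintype.card F % 4 = 3) (h2 : (2 : K) ≠ 0) (hι : ι ^ 2 = -1)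
    (hf : RootedFactorisation n 1 r s f α) (hg : RootedFactorisation n (-1) t k g β) :
    ∃ ψ : MonoidAlgebra F (QuaternionGroup n) ≃ₐ[F] AlgA F r s α × AlgB F t k β ι,
      ψ (.of F _ (QuaternionGroup.a 1)) = y ∧ ψ (.of F _ (QuaternionGroup.xa 0)) = z := by
  have hrel := h.quatRelations hι hf hg
  let φ := MonoidAlgebra.lift F (AlgA F r s α × AlgB F t k β ι) _ hrel.lift
  have ha : φ (.of F _ (QuaternionGroup.a 1)) = y := by
    rw [MonoidAlgebra.lift_of, hrel.lift_a_one]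
  have hb : φ (.of F _ (QuaternionGroup.xa 0)) = z := by
    rw [MonoidAlgebra.lift_of, hrel.lift_xa_zero]
  have hinj : Function.Injective φ := by
    rw [injective_iff_map_eq_zero]
    intro x hx
    obtain ⟨P, Q, rfl⟩ := exists_polynomial_form x
    rw [map_add, map_mul, ← aeval_algHom_apply, ← aeval_algHom_apply, ha, hb] at hx
    obtain ⟨hP, hQ⟩ := h.dvd_of_eq_zero hq h2 hι hf hg hx
    rw [aeval_a_one_eq_zero hP, aeval_a_one_eq_zero hQ, mul_zero, add_zero]
  obtain ⟨hAfin, hA⟩ := finrank_algA hf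
  obtain ⟨hBfin, hB⟩ := finrank_algB hq h2 hι hg
  have hdim : Module.finrank F (MonoidAlgebra F (QuaternionGroup n)) =
      Module.finrank F (AlgA F r s α × AlgB F t k β ι) := by
    rw [finrank_monoidAlgebra, Module.finrank_prod, hA, hB]
    ring
  have : FiniteDimensional F (MonoidAlgebra F (QuaternionGroup n)) :=
    FiniteDimensional.of_finrank_pos (by rw [finrank_monoidAlgebra]; have := NeZero.pos n; omega)
  have hsurj : Function.Surjective φ :=
    (LinearMap.injective_iff_surjective_of_finrank_eq_finrank hdim (f := φ.toLinearMap)).1 hinj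
  exact ⟨AlgEquiv.ofBijective φ ⟨hinj, hsurj⟩, ha, hb⟩

/-- `AreComponents` is kept beside `IsPsi` because it carries the invariant forms needed for
orthogonality. -/
theorem exists_isPsi [NeZero n] [Fintype F] (hq : Fintype.card F % 4 = 3) (h2 : (2 : K) ≠ 0)
    (hι : ι ^ 2 = -1)
    (hf : RootedFactorisation n 1 r s f α) (hg : RootedFactorisation n (-1) t k g β)
    {u v : ℕ → K} (huv : ∀ j ∈ Finset.Icc 2 t, ¬ 4 ∣ (g j).natDegree →
      u j ∈ F⟮β j + (β j)⁻¹⟯ ∧ v j ∈ F⟮β j + (β j)⁻¹⟯ ∧ u j ^ 2 + v j ^ 2 = -1) :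
    ∃ ψ : MonoidAlgebra F (QuaternionGroup n) ≃ₐ[F] AlgA F r s α × AlgB F t k β ι,
      IsPsi n r s t k g α β ι u v ψ ∧
      AreComponents (ψ (.of F _ (QuaternionGroup.a 1))) (ψ (.of F _ (QuaternionGroup.xa 0))) := by
  choose A₁ B₁ hA₁ hB₁ h₁ using fun i : Finset.Icc 2 r => exists_rho_self hf i.2
  choose A₂ B₂ hA₂ hB₂ h₂ using fun i : Finset.Icc (r + 1) (r + s) =>
    exists_rho_pair (F := F) (hf.root_ne_zero (hf.mem_of_pair i.2))
  choose A₃ B₃ hA₃ hB₃ h₃ using fun j : Finset.Icc 2 t =>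
    exists_eta_self hq h2 hι hg j.2 (huv j j.2)
  choose A₄ B₄ hA₄ hB₄ h₄ using fun j : Finset.Icc (t + 1) (t + k) =>
    exists_eta_pair (F := F) (hg.root_ne_zero (hg.mem_of_pair j.2))
  have hι' := IntermediateField.AdjoinSimple.coe_gen F ι
  have hc : AreComponents (F := F) (r := r) (s := s) (t := t) (k := k) (α := α) (β := β) (ι := ι)
      (((1, 1), A₁, A₂), (-1, A₃, A₄))
      (((1, -1), B₁, B₂), (IntermediateField.AdjoinSimple.gen F ι, B₃, B₄)) :=
    ⟨rfl, rfl, h₁, h₂, rfl, hι', h₃, h₄⟩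
  obtain ⟨ψ, hψa, hψb⟩ := hc.exists_algEquiv hq h2 hι hf hg
  refine ⟨ψ, ?_, by rwa [hψa, hψb]⟩
  constructor
  · rw [hψa]
    exact ⟨rfl, hA₁, hA₂⟩
  · rw [hψb]
    exact ⟨rfl, hB₁, hB₂⟩
  · rw [hψa]
    exact ⟨rfl, fun j => (hA₃ j).1, fun j => (hA₃ j).2, hA₄⟩
  · rw [hψb]
    exact ⟨hι', fun j => (hB₃ j).1, fun j => (hB₃ j).2, hB₄⟩

end Psi

/-! ### Self-orthogonality in terms of the components -/

section Criterion

variable {F K : Type*} [Field F] [Field K] [Algebra F K] {n : ℕ} [NeZero n]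

/-- Since `S` is invertible, it can be cancelled in φ(m · conj m) S = φ(m) S φ(m)ᵀ. -/
theorem IsComponent.map_mul_conj_eq_zero_iff {L : IntermediateField F K} {α ε₁ ε₂ : K} {S : M2 L}
    (φ : MonoidAlgebra F (QuaternionGroup n) →ₐ[F] M2 L)
    (h : IsComponent L α ε₁ ε₂ S (φ (.of F _ (QuaternionGroup.a 1)))
      (φ (.of F _ (QuaternionGroup.xa 0)))) (hS : S.det ≠ 0)
    (m : MonoidAlgebra F (QuaternionGroup n)) :
    φ (m * conj m) = 0 ↔ φ m * S * (φ m).transpose = 0 := by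
  rw [← map_mul_conj_mul_form φ S (h.form_of φ rfl rfl)]
  constructor
  · intro h
    rw [h, zero_mul]
  · intro h
    have := congrArg (· * S⁻¹) h
    simpa [mul_assoc, Matrix.mul_nonsing_inv _ (isUnit_iff_ne_zero.2 hS)] using this

/-- If inversion is the q-th power on the images of the generators, it is so on the whole group, and
m · conj m maps to φ(m)^(q + 1). -/
theorem map_mul_conj_eq_zero_iff [Fintype F] {L : Type*} [Field L] [Algebra F L]
    (φ : MonoidAlgebra F (QuaternionGroup n) →ₐ[F] L)
    (ha : (φ (.of F _ (QuaternionGroup.a 1)))⁻¹ =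
      φ (.of F _ (QuaternionGroup.a 1)) ^ Fintype.card F)
    (hb : (φ (.of F _ (QuaternionGroup.xa 0)))⁻¹ =
      φ (.of F _ (QuaternionGroup.xa 0)) ^ Fintype.card F)
    (m : MonoidAlgebra F (QuaternionGroup n)) : φ (m * conj m) = 0 ↔ φ m = 0 := by
  have hg : ∀ g, φ (.of F (QuaternionGroup n) g⁻¹) = φ (.of F _ g) ^ Fintype.card F := by
    intro g
    have hinv : φ (.of F (QuaternionGroup n) g⁻¹) = (φ (.of F _ g))⁻¹ := by
      refine eq_inv_of_mul_eq_one_left ?_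
      rw [← map_mul, ← map_mul, inv_mul_cancel, map_one, map_one]
    rw [hinv]
    induction g using quaternionGroup_induction with
    | one => rw [map_one, map_one, inv_one, one_pow]
    | mul g k hg hk =>
      have hg' := hg (eq_inv_of_mul_eq_one_left
        (by rw [← map_mul, ← map_mul, inv_mul_cancel, map_one, map_one]))
      have hk' := hk (eq_inv_of_mul_eq_one_left
        (by rw [← map_mul, ← map_mul, inv_mul_cancel, map_one, map_one]))
      rw [map_mul, map_mul, mul_inv, hg', hk', mul_pow]
    | ha => exact ha
    | hb => exact hb
  rw [map_mul, map_conj_eq_pow φ hg, mul_eq_zero, pow_eq_zero_iff Fintype.card_ne_zero, or_self]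

/-- The determinant is 4 - (α + α⁻¹)² = -(α - α⁻¹)². -/
theorem normForm_det_ne_zero {α : K} (h0 : α ≠ 0) (h1 : α ^ 2 ≠ 1) :
    (normForm F α).det ≠ 0 := by
  rw [normForm, Matrix.det_fin_two_of]
  intro h
  have h' := congrArg (fun x : F⟮α + α⁻¹⟯ => (x : K)) h
  change (2 : K) * 2 - (IntermediateField.AdjoinSimple.gen F (α + α⁻¹) : K) *
    (IntermediateField.AdjoinSimple.gen F (α + α⁻¹) : K) = 0 at h'
  rw [IntermediateField.AdjoinSimple.coe_gen] at h'
  apply inv_ne_self h0 h1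
  refine pow_eq_zero_iff two_ne_zero |>.1 ?_
  rw [← neg_eq_zero, ← h']
  field_simp
  ring

theorem span_lt_top_iff_field {L : Type*} [Field L] (x : L) : Ideal.span {x} < ⊤ ↔ x = 0 := by
  rw [lt_top_iff_ne_top, ne_eq, Ideal.span_singleton_eq_top, isUnit_iff_ne_zero, not_not]

variable {r s t k : ℕ} {f g : ℕ → F[X]} {α β : ℕ → K} {ι : K}

theorem mul_conj_eq_zero_iff [Fintype F]
    (hq : Fintype.card F % 4 = 3) (h2 : (2 : K) ≠ 0) (hι : ι ^ 2 = -1)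
    (hf : RootedFactorisation n 1 r s f α)
    (ψ : MonoidAlgebra F (QuaternionGroup n) ≃ₐ[F] AlgA F r s α × AlgB F t k β ι)
    (h : AreComponents (ψ (.of F _ (QuaternionGroup.a 1))) (ψ (.of F _ (QuaternionGroup.xa 0))))
    (m : MonoidAlgebra F (QuaternionGroup n)) (hm : AllRREF (ψ m).1 (ψ m).2) :
    m * conj m = 0 ↔ SelfOrthogonalConditions (ψ m).1 (ψ m).2 := by
  have h2L : ∀ L : IntermediateField F K, (2 : L) ≠ 0 := fun L h =>
    h2 (congrArg (fun z : L => (z : K)) h)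
  have hodd : Odd (Fintype.card F) := Nat.odd_iff.2 (by omega)
  let φ : MonoidAlgebra F (QuaternionGroup n) →ₐ[F] AlgA F r s α × AlgB F t k β ι := ψ
  let φA := (AlgHom.fst F _ _).comp φ
  let φB := (AlgHom.snd F _ _).comp φ
  let ρ := (AlgHom.fst F _ _).comp φA
  have hρ₁ := map_mul_conj_eq_zero_iff ((AlgHom.fst F F F).comp ρ)
    (by
      change ((ψ (.of F _ (QuaternionGroup.a 1))).1.1.1)⁻¹ = (ψ _).1.1.1 ^ _
      rw [h.rho_one_a]; simp)
    (by
      change ((ψ (.of F _ (QuaternionGroup.xa 0))).1.1.1)⁻¹ = (ψ _).1.1.1 ^ _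
      rw [h.rho_one_b]; simp) m
  have hρ₂ := map_mul_conj_eq_zero_iff ((AlgHom.snd F F F).comp ρ)
    (by
      change ((ψ (.of F _ (QuaternionGroup.a 1))).1.1.2)⁻¹ = (ψ _).1.1.2 ^ _
      rw [h.rho_one_a]; simp)
    (by
      change ((ψ (.of F _ (QuaternionGroup.xa 0))).1.1.2)⁻¹ = (ψ _).1.1.2 ^ _
      rw [h.rho_one_b, hodd.neg_one_pow, inv_neg, inv_one]) m
  have hA := fun i => ((h.rho_self i).map_mul_conj_eq_zero_iff
    ((Pi.evalAlgHom F _ i).comp ((AlgHom.fst F _ _).comp ((AlgHom.snd F _ _).comp φA)))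
    (normForm_det_ne_zero (hf.root_ne_zero (hf.mem_of_self i.2)) (hf.root_sq_ne_one i.2)) m).trans
    (mul_mul_transpose_eq_zero_iff_of_anisotropic (h2L _)
      (one_add_mul_add_sq_ne_zero _ _ (IntermediateField.AdjoinSimple.coe_gen F _)
        (hf.root_ne_zero (hf.mem_of_self i.2)) (hf.notMem i.2)) (hm.A_self i))
  have hA' := fun i => ((h.rho_pair i).map_mul_conj_eq_zero_iff
    ((Pi.evalAlgHom F _ i).comp ((AlgHom.snd F _ _).comp ((AlgHom.snd F _ _).comp φA)))
    (by simp) m).trans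
    (mul_mul_transpose_eq_zero_iff_of_hyperbolic (h2L _) (hm.A_pair i))
  -- Here q ≡ 3 mod 4 gives (√-1)^q = -√-1 = (√-1)⁻¹.
  have hη := map_mul_conj_eq_zero_iff ((AlgHom.fst F _ _).comp φB)
    (by
      change ((ψ (.of F _ (QuaternionGroup.a 1))).2.1)⁻¹ = (ψ _).2.1 ^ _
      rw [h.eta_one_a, hodd.neg_one_pow, inv_neg, inv_one])
    (by
      change ((ψ (.of F _ (QuaternionGroup.xa 0))).2.1)⁻¹ = (ψ _).2.1 ^ _
      apply Subtype.val_injective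
      rw [IntermediateField.coe_inv, IntermediateField.coe_pow, h.eta_one_b,
        pow_of_mod_four_eq_three hι hq]
      refine inv_eq_of_mul_eq_one_right ?_
      linear_combination -hι) m
  have hB := fun j => ((h.eta_self j).map_mul_conj_eq_zero_iff
    ((Pi.evalAlgHom F _ j).comp ((AlgHom.fst F _ _).comp ((AlgHom.snd F _ _).comp φB)))
    (by simp) m).trans (mul_mul_transpose_eq_zero_iff_of_symplectic _)
  have hB' := fun j => ((h.eta_pair j).map_mul_conj_eq_zero_iff
    ((Pi.evalAlgHom F _ j).comp ((AlgHom.snd F _ _).comp ((AlgHom.snd F _ _).comp φB)))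
    (by simp) m).trans (mul_mul_transpose_eq_zero_iff_of_symplectic _)
  have hone : Ideal.span {(ψ m).1.1} = ⊥ ↔ (ψ m).1.1.1 = 0 ∧ (ψ m).1.1.2 = 0 := by
    rw [Ideal.span_singleton_eq_bot, Prod.ext_iff]
    rfl
  rw [← map_eq_zero_iff ψ ψ.injective]
  constructor
  · intro h0
    refine ⟨hone.2 ⟨hρ₁.1 ?_, hρ₂.1 ?_⟩, fun i => (hA i).1 ?_, fun i => (hA' i).1 ?_,
      (span_lt_top_iff_field _).2 (hη.1 ?_), fun j => (hB j).1 ?_, fun j => (hB' j).1 ?_⟩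
    · exact congrArg (fun x => x.1.1.1) h0
    · exact congrArg (fun x => x.1.1.2) h0
    · exact congrArg (fun x => x.1.2.1 i) h0
    · exact congrArg (fun x => x.1.2.2 i) h0
    · exact congrArg (fun x => x.2.1) h0
    · exact congrArg (fun x => x.2.2.1 j) h0
    · exact congrArg (fun x => x.2.2.2 j) h0
  · intro hS
    refine Prod.ext (Prod.ext (Prod.ext (hρ₁.2 (hone.1 hS.A_one).1) (hρ₂.2 (hone.1 hS.A_one).2))
      (Prod.ext (funext fun i => (hA i).2 (hS.A_self i)) (funext fun i => (hA' i).2 (hS.A_pair i))))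
      (Prod.ext (hη.2 ((span_lt_top_iff_field _).1 hS.B_one))
        (Prod.ext (funext fun j => (hB j).2 (hS.B_self j)) (funext fun j => (hB' j).2 (hS.B_pair j))))

end Criterion

/-! ### Transport of left ideals and their generators along an algebra isomorphism. -/

section Transport

variable {R S F : Type*} [CommSemiring F] [Ring R] [Ring S] [Algebra F R] [Algebra F S]

theorem image_eq_span_iff (ψ : R ≃ₐ[F] S) (I : Ideal R) (m : S) :
    ψ '' (I : Set R) = (Ideal.span {m} : Ideal S) ↔ I = Ideal.span {ψ.symm m} := by
  have key : ∀ x, x ∈ Ideal.span {ψ.symm m} ↔ ψ x ∈ Ideal.span {m} := by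
    intro x
    rw [Ideal.mem_span_singleton', Ideal.mem_span_singleton']
    constructor
    · rintro ⟨a, rfl⟩
      exact ⟨ψ a, by rw [map_mul, ψ.apply_symm_apply]⟩
    · rintro ⟨a, ha⟩
      exact ⟨ψ.symm a, by rw [← map_mul, ha, ψ.symm_apply_apply]⟩
  constructor
  · intro h
    ext x
    rw [key, ← SetLike.mem_coe (p := Ideal.span {m}), ← h]
    exact (ψ.injective.mem_set_image (s := (I : Set R))).symm
  · rintro rfl
    ext y
    constructor
    · rintro ⟨x, hx, rfl⟩
      exact (key x).1 hx
    · intro hy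
      refine ⟨ψ.symm y, (key _).2 ?_, ψ.apply_symm_apply y⟩
      rwa [ψ.apply_symm_apply]

theorem HasNormalGenerators.existsUnique_image {P : S → Prop} (h : HasNormalGenerators S P)
    (ψ : R ≃ₐ[F] S) (I : Ideal R) :
    ∃! m, P m ∧ ψ '' (I : Set R) = (Ideal.span {m} : Ideal S) := by
  have e : ψ '' (I : Set R) = (I.comap (ψ.symm : S →+* R) : Ideal S) := by
    ext y
    constructor
    · rintro ⟨x, hx, rfl⟩
      change ψ.symm (ψ x) ∈ I
      rwa [ψ.symm_apply_apply]
    · intro hy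
      exact ⟨ψ.symm y, hy, ψ.apply_symm_apply y⟩
  simp only [e, SetLike.coe_set_eq]
  exact h _

end Transport

/-! ### Counting -/

section Count

theorem card_subtype_prod {R S : Type*} {P : R → Prop} {Q : S → Prop} {a b : ℕ}
    (hP : Nat.card {x // P x} = a) (hQ : Nat.card {x // Q x} = b) :
    Nat.card {x : R × S // P x.1 ∧ Q x.2} = a * b := by
  rw [Nat.card_congr Equiv.subtypeProdEquivProd, Nat.card_prod, hP, hQ]

theorem card_subtype_pi {I : Type*} [Fintype I] {R : I → Type*} {P : ∀ i, R i → Prop} {a : I → ℕ}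
    (hP : ∀ i, Nat.card {x // P i x} = a i) :
    Nat.card {x : ∀ i, R i // ∀ i, P i (x i)} = ∏ i, a i := by
  rw [Nat.card_congr Equiv.subtypePiEquivPi, Nat.card_pi]
  exact Finset.prod_congr rfl fun i _ => hP i

theorem card_eq_zero_subtype (R : Type*) [Zero R] : Nat.card {x : R // x = 0} = 1 :=
  Nat.card_unique

/-- Excluding the identity leaves the zero matrix, the row (0, 1) and the |L| rows (1, c). -/
theorem card_isRREF_lt_top (L : Type*) [Field L] [Finite L] :
    Nat.card {M : M2 L // IsRREF M ∧ Ideal.span {M} < ⊤} = Nat.card L + 2 := by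
  have e : Option (Option L) ≃ {M : M2 L // IsRREF M ∧ Ideal.span {M} < ⊤} := by
    refine Equiv.ofBijective (fun
      | none => ⟨!![0, 0; 0, 0], Or.inl rfl, (span_lt_top_iff_det _).2 (by simp)⟩
      | some none => ⟨!![0, 1; 0, 0], Or.inr (Or.inl rfl), (span_lt_top_iff_det _).2 (by simp)⟩
      | some (some c) => ⟨!![1, c; 0, 0], Or.inr (Or.inr (Or.inl ⟨c, rfl⟩)),
          (span_lt_top_iff_det _).2 (by simp)⟩) ⟨?_, ?_⟩
    · rintro (_ | _ | c) (_ | _ | d) h <;> simp at h ⊢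
      exact h
    · rintro ⟨M, rfl | rfl | ⟨c, rfl⟩ | rfl, hM⟩
      · exact ⟨none, rfl⟩
      · exact ⟨some none, rfl⟩
      · exact ⟨some (some c), rfl⟩
      · rw [span_one_matrix] at hM
        exact absurd hM (lt_irrefl _)
  rw [← Nat.card_congr e, Finite.card_option, Finite.card_option]

theorem card_isotropic_hyperbolic (L : Type*) [Field L] :
    Nat.card {M : M2 L // M = !![0, 0; 0, 0] ∨ M = !![0, 1; 0, 0] ∨ M = !![1, 0; 0, 0]} = 3 := by
  refine (Nat.card_coe_set_eq ({!![0, 0; 0, 0], !![0, 1; 0, 0], !![1, 0; 0, 0]} : Set (M2 L))).trans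
    (Set.ncard_eq_three.2 ⟨_, _, _, ?_, ?_, ?_, rfl⟩) <;>
  simp

variable {F K : Type*} [Field F] [Field K] [Algebra F K] {r s t k : ℕ} {α β : ℕ → K} {ι : K}

/-- Decouples the components, so that the count becomes a product. -/
theorem allRREF_and_conditions_iff (x : AlgA F r s α × AlgB F t k β ι) :
    AllRREF x.1 x.2 ∧ SelfOrthogonalConditions x.1 x.2 ↔
      (x.1.1 = 0 ∧ (∀ i, x.1.2.1 i = 0) ∧ ∀ i, x.1.2.2 i = !![0, 0; 0, 0] ∨
        x.1.2.2 i = !![0, 1; 0, 0] ∨ x.1.2.2 i = !![1, 0; 0, 0]) ∧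
      (x.2.1 = 0 ∧ (∀ j, IsRREF (x.2.2.1 j) ∧ Ideal.span {x.2.2.1 j} < ⊤) ∧
        ∀ j, IsRREF (x.2.2.2 j) ∧ Ideal.span {x.2.2.2 j} < ⊤) := by
  constructor
  · rintro ⟨h, h'⟩
    exact ⟨⟨Ideal.span_singleton_eq_bot.1 h'.A_one,
        fun i => Ideal.span_singleton_eq_bot.1 (h'.A_self i), h'.A_pair⟩,
      (span_lt_top_iff_field _).1 h'.B_one, fun j => ⟨h.B_self j, h'.B_self j⟩,
      fun j => ⟨h.B_pair j, h'.B_pair j⟩⟩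
  · rintro ⟨⟨h1, h2, h3⟩, h4, h5, h6⟩
    refine ⟨⟨?_, fun i => Or.inl ?_, fun i => ?_, Or.inl h4, fun j => (h5 j).1, fun j => (h6 j).1⟩,
      ⟨Ideal.span_singleton_eq_bot.2 h1, fun i => Ideal.span_singleton_eq_bot.2 (h2 i), h3,
        (span_lt_top_iff_field _).2 h4, fun j => (h5 j).2, fun j => (h6 j).2⟩⟩
    · rw [h1]
      exact ⟨Or.inl rfl, Or.inl rfl⟩
    · rw [h2 i, Matrix.eta_fin_two 0]
      rfl
    · rcases h3 i with h | h | h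
      · exact Or.inl h
      · exact Or.inr (Or.inl h)
      · exact Or.inr (Or.inr (Or.inl ⟨0, h⟩))

theorem card_eq_pow_finrank [Fintype F] (L : IntermediateField F K) [FiniteDimensional F L] :
    Nat.card L = Fintype.card F ^ Module.finrank F L := by
  rw [Module.natCard_eq_pow_finrank (K := F), Nat.card_eq_fintype_card]

theorem card_conditions [Fintype F] {n : ℕ} {e : F} {g : ℕ → F[X]}
    (hg : RootedFactorisation n e t k g β) :
    Nat.card {x : AlgA F r s α × AlgB F t k β ι //
      AllRREF x.1 x.2 ∧ SelfOrthogonalConditions x.1 x.2} =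
      3 ^ s * (∏ j ∈ Finset.Icc 2 t, (Fintype.card F ^ ((g j).natDegree / 2) + 2)) *
        ∏ j ∈ Finset.Icc (t + 1) (t + k), (Fintype.card F ^ (g j).natDegree + 2) := by
  have hself : ∀ j : Finset.Icc 2 t, Nat.card {M : M2 F⟮β j + (β j)⁻¹⟯ //
      IsRREF M ∧ Ideal.span {M} < ⊤} = Fintype.card F ^ ((g j).natDegree / 2) + 2 := by
    intro j
    have := hg.finiteDimensional_self j.2
    have := Module.finite_of_finite F (M := F⟮β j + (β j)⁻¹⟯)
    rw [card_isRREF_lt_top, card_eq_pow_finrank, ← hg.two_mul_finrank j.2,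
      Nat.mul_div_cancel_left _ two_pos]
  have hpair : ∀ j : Finset.Icc (t + 1) (t + k), Nat.card {M : M2 F⟮β j⟯ //
      IsRREF M ∧ Ideal.span {M} < ⊤} = Fintype.card F ^ (g j).natDegree + 2 := by
    intro j
    have := hg.finiteDimensional_pair (hg.mem_of_pair j.2)
    have := Module.finite_of_finite F (M := F⟮β j⟯)
    rw [card_isRREF_lt_top, card_eq_pow_finrank, ← hg.finrank_pair (hg.mem_of_pair j.2)]
  have hA := card_subtype_prod (card_eq_zero_subtype (F × F)) (card_subtype_prod
    (card_subtype_pi fun i : Finset.Icc 2 r => card_eq_zero_subtype (M2 F⟮α i + (α i)⁻¹⟯))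
    (card_subtype_pi fun i : Finset.Icc (r + 1) (r + s) => card_isotropic_hyperbolic F⟮α i⟯))
  have hB := card_subtype_prod (card_eq_zero_subtype F⟮ι⟯)
    (card_subtype_prod (card_subtype_pi hself) (card_subtype_pi hpair))
  have hAB := card_subtype_prod hA hB
  simp only [allRREF_and_conditions_iff]
  refine hAB.trans ?_
  rw [Finset.prod_coe_sort (Finset.Icc 2 t)
      (fun j => Fintype.card F ^ ((g j).natDegree / 2) + 2),
    Finset.prod_coe_sort (Finset.Icc (t + 1) (t + k))
      (fun j => Fintype.card F ^ (g j).natDegree + 2), Finset.prod_const_one, Finset.prod_const,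
    Finset.card_univ, Fintype.card_coe, Nat.card_Icc, one_mul, one_mul, one_mul, mul_assoc,
    show r + s + 1 - (r + 1) = s by omega]

end Count

end QuatCode

/-! ### The main theorem. -/

open QuatCode
theorem corollary4p10 {F K : Type*} [Field F] [Fintype F] [Field K] [Algebra F K]
    (q n : ℕ) [NeZero n] (hq : Fintype.card F = q) (hqn : Nat.Coprime q (4 * n))
    (hq4 : q % 4 = 3) (hn : Odd n)
    (r s t k : ℕ) (f g : ℕ → F[X])
    (hf : IsReciprocalFactorisation (X ^ n - 1) (X - 1) r s f)
    (hg : IsReciprocalFactorisation (X ^ n + 1) (X + 1) t k g)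
    (α β : ℕ → K)
    (hα : ∀ i ∈ Finset.Icc 1 (r + s), aeval (α i) (f i) = 0)
    (hβ : ∀ j ∈ Finset.Icc 1 (t + k), aeval (β j) (g j) = 0)
    (ι : K) (hι : ι ^ 2 = -1)
    (u v : ℕ → K)
    (huv : ∀ j ∈ Finset.Icc 2 t, ¬ 4 ∣ (g j).natDegree →
      u j ∈ F⟮β j + (β j)⁻¹⟯ ∧ v j ∈ F⟮β j + (β j)⁻¹⟯ ∧ u j ^ 2 + v j ^ 2 = -1) :
    (∃ ψ : MonoidAlgebra F (QuaternionGroup n) ≃ₐ[F] AlgA F r s α × AlgB F t k β ι,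
      IsPsi n r s t k g α β ι u v ψ ∧
      (∀ I : Ideal (MonoidAlgebra F (QuaternionGroup n)),
        ∃! MN : AlgA F r s α × AlgB F t k β ι,
          AllRREF MN.1 MN.2 ∧ ψ '' (I : Set _) = sumSpan MN.1 MN.2) ∧
      (∀ (I : Ideal (MonoidAlgebra F (QuaternionGroup n)))
        (M : AlgA F r s α) (N : AlgB F t k β ι),
        AllRREF M N → ψ '' (I : Set _) = sumSpan M N →
          (IsSelfOrthogonal I ↔ SelfOrthogonalConditions M N))) ∧
    Nat.card {I : Ideal (MonoidAlgebra F (QuaternionGroup n)) // IsSelfOrthogonal I} =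
      3 ^ s * (∏ j ∈ Finset.Icc 2 t, (q ^ ((g j).natDegree / 2) + 2)) *
        ∏ j ∈ Finset.Icc (t + 1) (t + k), (q ^ (g j).natDegree + 2) := by
  subst hq
  have hn0 := natCast_ne_zero_of_coprime_card (hqn.coprime_dvd_right (Dvd.intro_left 4 rfl))
  have h2 : (2 : K) ≠ 0 := by
    have h4 := natCast_ne_zero_of_coprime_card (hqn.coprime_dvd_right (Dvd.intro n rfl))
    intro h
    apply h4
    apply (algebraMap F K).injective
    rw [map_natCast, map_zero]
    push_cast
    linear_combination 2 * h
  -- X^n - 1 and X^n + 1 are the cases e = 1 and e = -1 of X^n - e.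
  have hf' : RootedFactorisation n 1 r s f α :=
    ⟨hn, one_pow 2, hn0, by rwa [C_1], hα⟩
  have hg' : RootedFactorisation n (-1) t k g β :=
    ⟨hn, neg_one_sq, hn0, by rwa [C_neg, C_1, sub_neg_eq_add, sub_neg_eq_add], hβ⟩
  obtain ⟨ψ, hψ, hc⟩ := exists_isPsi hq4 h2 hι hf' hg' huv
  have hnormal := (hasNormalGenerators_allRREF (F := F) (r := r) (s := s) (t := t) (k := k)
    (α := α) (β := β) (ι := ι)).existsUnique_image ψ
  have hspan : ∀ x, AllRREF x.1 x.2 → (IsSelfOrthogonal (Ideal.span {ψ.symm x}) ↔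
      SelfOrthogonalConditions x.1 x.2) := by
    intro x hx
    have := mul_conj_eq_zero_iff hq4 h2 hι hf' ψ hc (ψ.symm x)
    rw [ψ.apply_symm_apply] at this
    rw [isSelfOrthogonal_span_iff, this hx]
  refine ⟨⟨ψ, hψ, ?_, ?_⟩, ?_⟩
  · simpa only [sumSpan_eq_span] using hnormal
  · intro I M N hMN hI
    rw [sumSpan_eq_span, image_eq_span_iff] at hI
    rw [hI]
    exact hspan (M, N) hMN
  · rw [← card_conditions (r := r) (s := s) (α := α) (ι := ι) hg']
    -- Sending an admissible reduced tuple to the ideal it generates is bijective: injective by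
    -- uniqueness of reduced generators, surjective by their existence.
    refine (Nat.card_congr (Equiv.ofBijective
      (fun x => ⟨Ideal.span {ψ.symm x.1}, (hspan x.1 x.2.1).2 x.2.2⟩) ⟨?_, ?_⟩)).symm
    · rintro ⟨x, hx⟩ ⟨y, hy⟩ h
      have h' := congrArg Subtype.val h
      exact Subtype.ext ((hnormal (Ideal.span {ψ.symm x})).unique
        ⟨hx.1, (image_eq_span_iff ψ _ _).2 rfl⟩ ⟨hy.1, (image_eq_span_iff ψ _ _).2 h'⟩)
    · rintro ⟨I, hI⟩
      obtain ⟨x, ⟨hx, hIx⟩, -⟩ := hnormal I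
      rw [image_eq_span_iff] at hIx
      subst hIx
      exact ⟨⟨x, hx, (hspan x hx).1 hI⟩, rfl⟩
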